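/- **Setting.** For $D\ge 1$, a state of a $D\times D$ system is a unit vector of $\mathbb C^D\otimes\mathbb C^D$, considered up to an overall phase. It is entangled if it is not a product vector, and it is maximally entangled of Schmidt rank $D$ if it equals $D^{-1/2}\sum_{k}|u_k\rangle|v_k\rangle$ for some orthonormal bases $(u_k)$, $(v_k)$ of $\mathbb C^D$. Alice holds the systems $A,a$ and Bob holds $B,b$, all four of dimension $D$. A separable operation (across the cut $Aa|Bb$) is a map $\rho\mapsto\sum_{m}(A_m\otimes B_m)\rho(A_m\otimes B_m)^\dagger$ with finitely many Kraus operators satisfying $\sum_m A_m^\dagger A_m\otimes B_m^\dagger B_m=I$, where $A_m$ acts on $Aa$ and $B_m$ on $Bb$; an LOCC operation is a deterministic one realized by finitely many rounds of local generalized measurements (with finite-dimensional local ancillas) and classical communication. A family of states $(|\psi_i\rangle)_i$ of a $D\times D$ system can be locally cloned with the blank state $|\phi\rangle$ (also a state of a $D\times D$ system) by separable operations (resp. by LOCC) if one and the same separable (resp. LOCC) operation maps $|\psi_i\rangle^{AB}\otimes|\phi\rangle^{ab}$ to $|\psi_i\rangle^{AB}\otimes|\psi_i\rangle^{ab}$ with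 probability one, for every $i$. **Theorem (Necessity of a maximally entangled blank).** (i) Let $|\psi_0\rangle,|\psi_1\rangle$ be two orthogonal entangled two-qubit states ($D=2$) and let $|\phi\rangle$ be a two-qubit state. Then $\{|\psi_0\rangle,|\psi_1\rangle\}$ can be locally cloned with blank state $|\phi\rangle$ by a separable operation if and only if $|\phi\rangle$ is maximally entangled (of Schmidt rank $2$) and, in suitable local orthonormal bases (the same for both states) and up to an overall phase of $|\psi_1\rangle$, $$|\psi_0\rangle=\sqrt{\lambda}\,|0\rangle|0\rangle+\sqrt{1-\lambda}\,|1\rangle|1\rangle$$ and $$|\psi_1\rangle=\sqrt{\lambda}\,|0\rangle|1\rangle+\sqrt{1-\lambda}\,|1\rangle|0\rangle\quad\text{or}\quad|\psi_1\rangle=\sqrt{\lambda}\,|1\rangle|0\rangle+\sqrt{1-\lambda}\,|0\rangle|1\rangle$$ for some $0<\lambda<1$. The same equivalence holds with LOCC in place of separable operations. In particular, a maximally entangled blank state is necessary for locally cloning two entangled qubit states, and it is sufficient whenever they can be locally cloned at all. (ii) Let $G$ be a group of order $3$ and let $(|\psi_f\rangle)_{f\in G}$ be group-shifted qutrit states ($D=3$)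 of full Schmidt rank, that is, in suitable local orthonormal bases indexed by $G$, either $$|\psi_f\rangle=\sum_{g\in G}\sqrt{\lambda_g}\,e^{i\vartheta_{f,g}}|g\rangle^A|fg\rangle^B\ \text{ for all } f\in G,\quad\text{or}\quad|\psi_f\rangle=\sum_{g\in G}\sqrt{\lambda_g}\,e^{i\vartheta_{f,g}}|fg\rangle^A|g\rangle^B\ \text{ for all } f\in G,$$ with $\lambda_g>0$, $\sum_g\lambda_g=1$ and real $\vartheta_{f,g}$. If these three states can be locally cloned with a two-qutrit blank state $|\phi\rangle$ by a separable operation, or by LOCC, then $|\phi\rangle$ is maximally entangled (of Schmidt rank $3$). If moreover all $\vartheta_{f,g}=0$, then this condition is also sufficient: the three states can be locally cloned with blank $|\phi\rangle$, by LOCC as well as by a separable operation, if and only if $|\phi\rangle$ is maximally entangled. -/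

import Mathlib

open scoped Kronecker

noncomputable section

namespace LocalCloning

/-- State vectors of a bipartite quantum system whose two parts both have dimension `D`, in
coordinates with respect to a product basis.  (Normalization is imposed separately.) -/
abbrev Ket (D : ℕ) : Type := EuclideanSpace ℂ (Fin D × Fin D)

/-- The product vector `x ⊗ y`. -/
def prodKet {D : ℕ} (x y : EuclideanSpace ℂ (Fin D)) : Ket D :=
  WithLp.toLp 2 (fun p => x p.1 * y p.2)

/-- A bipartite pure state is entangled if it is not a product vector. -/
def IsEntangled {D : ℕ} (χ : Ket D) : Prop :=
  ¬ ∃ x y : EuclideanSpace ℂ (Fin D), χ = prodKet x y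

/-- `c` lists the `D` Schmidt coefficients of `χ` (with multiplicity, in some order):
`χ = ∑ k, √(c k) • u k ⊗ v k` for suitable orthonormal bases `u`, `v`. -/
def HasSchmidtCoeffs {D : ℕ} (χ : Ket D) (c : Fin D → ℝ) : Prop :=
  (∀ k, 0 ≤ c k) ∧
  ∃ u v : OrthonormalBasis (Fin D) ℂ (EuclideanSpace ℂ (Fin D)),
    χ = ∑ k, (Real.sqrt (c k) : ℂ) • prodKet (u k) (v k)

/-- A maximally entangled state of Schmidt rank `D`: all the `D` Schmidt coefficients are equal
to `1 / D`. -/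
def IsMaximallyEntangled {D : ℕ} (χ : Ket D) : Prop :=
  HasSchmidtCoeffs χ (fun _ => 1 / (D : ℝ))

/-- The four-partite vector `ψ^{AB} ⊗ χ^{ab}`, arranged along the cut `Aa / Bb`: Alice holds the
index `(A, a)`, Bob holds the index `(B, b)`. -/
def joint {D : ℕ} (ψ χ : Ket D) : (Fin D × Fin D) × (Fin D × Fin D) → ℂ :=
  fun x => ψ (x.1.1, x.2.1) * χ (x.1.2, x.2.2)

/-- The density operator `|v⟩⟨v|`. -/
def ketbra {ι : Type} (v : ι → ℂ) : Matrix ι ι ℂ := Matrix.vecMulVec v (star v)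

/-- Separable operations on a bipartite system: finitely many product Kraus operators
`A m ⊗ B m` satisfying the closure condition. -/
def IsSeparableOperation {α β : Type} [Fintype α] [DecidableEq α] [Fintype β] [DecidableEq β]
    (L : Matrix (α × β) (α × β) ℂ → Matrix (α × β) (α × β) ℂ) : Prop :=
  ∃ (M : ℕ) (A : Fin M → Matrix α α ℂ) (B : Fin M → Matrix β β ℂ),
    (∑ m, ((A m).conjTranspose * A m) ⊗ₖ ((B m).conjTranspose * B m)
      = (1 : Matrix α α ℂ) ⊗ₖ (1 : Matrix β β ℂ)) ∧
    ∀ ρ, L ρ = ∑ m, (A m ⊗ₖ B m) * ρ * (A m ⊗ₖ B m).conjTranspose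

/-- Deterministic operations by local operations and (finitely many rounds of) classical
communication, with final systems `α'` (Alice) and `β'` (Bob).  A protocol either stops, or one
party performs a local generalized measurement, given by Kraus operators that satisfy the local
closure condition, and the rest of the protocol may depend on the outcome.  The dimension of the
measured system may change, so that local ancillas can be added or discarded. -/
inductive IsLOCC {α' β' : Type} [Fintype α'] [DecidableEq α'] [Fintype β'] [DecidableEq β'] :
    (α β : Type) → [Fintype α] → [DecidableEq α] → [Fintype β] → [DecidableEq β] →
    (Matrix (α × β) (α × β) ℂ → Matrix (α' × β') (α' × β') ℂ) → Prop
  | done : IsLOCC α' β' (fun ρ => ρ)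
  | alice {α β : Type} [Fintype α] [DecidableEq α] [Fintype β] [DecidableEq β]
      {n : ℕ} {γ : Fin n → Type} [∀ r, Fintype (γ r)] [∀ r, DecidableEq (γ r)]
      (K : (r : Fin n) → Matrix (γ r) α ℂ)
      (hK : ∑ r, (K r).conjTranspose * K r = 1)
      (L : (r : Fin n) → Matrix (γ r × β) (γ r × β) ℂ → Matrix (α' × β') (α' × β') ℂ)
      (hL : ∀ r, IsLOCC (γ r) β (L r)) :
      IsLOCC α β (fun ρ => ∑ r, L r
        ((K r ⊗ₖ (1 : Matrix β β ℂ)) * ρ * (K r ⊗ₖ (1 : Matrix β β ℂ)).conjTranspose))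
  | bob {α β : Type} [Fintype α] [DecidableEq α] [Fintype β] [DecidableEq β]
      {n : ℕ} {γ : Fin n → Type} [∀ r, Fintype (γ r)] [∀ r, DecidableEq (γ r)]
      (K : (r : Fin n) → Matrix (γ r) β ℂ)
      (hK : ∑ r, (K r).conjTranspose * K r = 1)
      (L : (r : Fin n) → Matrix (α × γ r) (α × γ r) ℂ → Matrix (α' × β') (α' × β') ℂ)
      (hL : ∀ r, IsLOCC α (γ r) (L r)) :
      IsLOCC α β (fun ρ => ∑ r, L r
        (((1 : Matrix α α ℂ) ⊗ₖ K r) * ρ * ((1 : Matrix α α ℂ) ⊗ₖ K r).conjTranspose))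

/-- The operation `L` clones the states `ψ i` onto the blank state `φ`:
`ψ i ⊗ φ ⟶ ψ i ⊗ ψ i` with probability one, for every `i`. -/
def Clones {D : ℕ} {ι : Type}
    (L : Matrix ((Fin D × Fin D) × (Fin D × Fin D)) ((Fin D × Fin D) × (Fin D × Fin D)) ℂ →
      Matrix ((Fin D × Fin D) × (Fin D × Fin D)) ((Fin D × Fin D) × (Fin D × Fin D)) ℂ)
    (ψ : ι → Ket D) (φ : Ket D) : Prop :=
  ∀ i, L (ketbra (joint (ψ i) φ)) = ketbra (joint (ψ i) (ψ i))

/-- The states `ψ i` can be cloned with blank `φ` by a separable operation (along `Aa / Bb`). -/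
def SeparablyClonable {D : ℕ} {ι : Type} (ψ : ι → Ket D) (φ : Ket D) : Prop :=
  ∃ L, IsSeparableOperation L ∧ Clones L ψ φ

/-- The states `ψ i` can be cloned with blank `φ` by LOCC (along `Aa / Bb`). -/
def LOCCClonable {D : ℕ} {ι : Type} (ψ : ι → Ket D) (φ : Ket D) : Prop :=
  ∃ L, IsLOCC (Fin D × Fin D) (Fin D × Fin D) L ∧ Clones L ψ φ

/-- A pair of two-qubit states of shifted form, in suitable local orthonormal bases and up to an
overall phase `c` of the second state. -/
def IsShiftedPair (ψ : Fin 2 → Ket 2) : Prop :=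
  ∃ (u v : OrthonormalBasis (Fin 2) ℂ (EuclideanSpace ℂ (Fin 2))) (l : ℝ) (c : ℂ),
    0 < l ∧ l < 1 ∧ ‖c‖ = 1 ∧
    ψ 0 = (Real.sqrt l : ℂ) • prodKet (u 0) (v 0)
      + (Real.sqrt (1 - l) : ℂ) • prodKet (u 1) (v 1) ∧
    (ψ 1 = c • ((Real.sqrt l : ℂ) • prodKet (u 0) (v 1)
        + (Real.sqrt (1 - l) : ℂ) • prodKet (u 1) (v 0)) ∨
     ψ 1 = c • ((Real.sqrt l : ℂ) • prodKet (u 1) (v 0)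
        + (Real.sqrt (1 - l) : ℂ) • prodKet (u 0) (v 1)))

/-- `D` group-shifted states of full Schmidt rank, with Schmidt coefficients `l g` and phases
`θ f g`, in suitable local orthonormal bases indexed by the group `G` (which therefore has order
`D`).  The shift acts on Bob's side, or it acts on Alice's side. -/
def IsGroupShifted {D : ℕ} {G : Type} [Group G] [Fintype G]
    (l : G → ℝ) (θ : G → G → ℝ) (ψ : G → Ket D) : Prop :=
  (∀ g, 0 < l g) ∧ ∑ g, l g = 1 ∧
  ∃ u v : OrthonormalBasis G ℂ (EuclideanSpace ℂ (Fin D)),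
    (∀ f, ψ f = ∑ g, ((Real.sqrt (l g) : ℂ) * Complex.exp (Complex.I * (θ f g : ℂ))) •
        prodKet (u g) (v (f * g))) ∨
    (∀ f, ψ f = ∑ g, ((Real.sqrt (l g) : ℂ) * Complex.exp (Complex.I * (θ f g : ℂ))) •
        prodKet (u (f * g)) (v g))

end LocalCloning

end

/-!
# Local cloning of entangled states needs a maximally entangled blank

A bipartite vector is read as the matrix of its coordinates.  A Kraus operator `A ⊗ B` of a
separable cloning operation then satisfies `A (Ψᵢ ⊗ Φ) Bᵀ = cᵢ Ψᵢ ⊗ Ψᵢ`, and the closure condition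
fixes the sum of `‖A‖² ‖B‖²` (Hilbert–Schmidt norms) over all Kraus operators.  LOCC operations
are separable, so all necessary conditions are derived from this data (`MatrixClonable`).

*Shape of two qubit states.*  Determinants show that the states are equally entangled.  If
`Ψ₁ = T Ψ₀`, then `A` intertwines `T ⊗ 1` with a multiple of `T ⊗ T` (`kraus_intertwines`).  For
`2 × 2` matrices this makes `T` scalar or traceless (`trace_eq_zero_of_intertwines`), and
orthogonality excludes the former.  A traceless `T`, equal norms and determinants, and
orthogonality leave only the shifted pairs (`exists_bases_antidiagonal`,
`isShiftedPair_of_antidiagonal`).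

*Maximal entanglement of the blank.*  For group-shifted states `T` is a permutation matrix up to
phases.  Therefore the moduli of the entries of `A⁻¹`, and with it of `B` up to weights made of the
Schmidt coefficients, are invariant under simultaneous shifts.  Averaging over the group replaces
the weights by sums `∑ f, l (f g) l (f h) / l (f k)`, which are at least `1` for groups with at most
three elements (`sum_le_sum_shifted_ratio`).  With the Cauchy–Schwarz inequality for the trace of
`A⁻¹ A`, weighted by the inverse singular values `1 / sₖ` of the blank, and the closure condition,
this gives `(∑ 1 / sₖ)² ≤ D³` (`kraus_frobSq_lower_bound`).  As `∑ sₖ² = 1`, all `sₖ` are equal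
(`eq_const_of_sum_inv_le`).

*Sufficiency.*  With a maximally entangled blank, controlled shifts on both sides and one local
measurement weighted by the Schmidt coefficients clone the shifted states; the outcome tells both
parties how to shift back (`exists_cloning_kraus`).
-/

open scoped Kronecker

namespace LocalCloning

/-! ### Frobenius norms, unitary matrices and singular values -/

section Matrices

open scoped ComplexOrder

variable {l m n p : Type*} [Fintype l] [Fintype m] [Fintype n] [Fintype p]

/-- The square of the Frobenius norm of a matrix. -/
noncomputable def frobSq (A : Matrix m n ℂ) : ℝ := ∑ i, ∑ j, ‖A i j‖ ^ 2

theorem frobSq_nonneg (A : Matrix m n ℂ) : 0 ≤ frobSq A := by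
  unfold frobSq; positivity

theorem frobSq_smul (c : ℂ) (A : Matrix m n ℂ) : frobSq (c • A) = ‖c‖ ^ 2 * frobSq A := by
  simp [frobSq, Finset.mul_sum, mul_pow]

theorem frobSq_transpose (A : Matrix m n ℂ) : frobSq A.transpose = frobSq A := by
  unfold frobSq
  rw [Finset.sum_comm]
  rfl

theorem trace_conjTranspose_mul_self_eq_frobSq (A : Matrix m n ℂ) :
    (A.conjTranspose * A).trace = (frobSq A : ℂ) := by
  simp only [Matrix.trace, Matrix.diag, Matrix.mul_apply, Matrix.conjTranspose_apply, frobSq]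
  rw [Finset.sum_comm]
  push_cast
  refine Finset.sum_congr rfl fun i _ => Finset.sum_congr rfl fun j _ => ?_
  rw [Complex.star_def, Complex.conj_mul']

theorem frobSq_pos {A : Matrix m n ℂ} (hA : A ≠ 0) : 0 < frobSq A := by
  obtain ⟨i, j, hij⟩ : ∃ i j, A i j ≠ 0 := by
    by_contra! h
    exact hA (Matrix.ext h)
  calc 0 < ‖A i j‖ ^ 2 := by positivity
    _ ≤ ∑ j, ‖A i j‖ ^ 2 :=
      Finset.single_le_sum (f := fun j => ‖A i j‖ ^ 2) (fun _ _ => by positivity)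
        (Finset.mem_univ j)
    _ ≤ frobSq A :=
      Finset.single_le_sum (f := fun i => ∑ j, ‖A i j‖ ^ 2) (fun _ _ => by positivity)
        (Finset.mem_univ i)

/-- The Cauchy–Schwarz inequality for the Hilbert–Schmidt inner product. -/
theorem norm_trace_mul_sq_le (A : Matrix m n ℂ) (B : Matrix n m ℂ) :
    ‖(A * B).trace‖ ^ 2 ≤ frobSq A * frobSq B := by
  have h1 : ‖(A * B).trace‖ ≤ ∑ x : m × n, ‖A x.1 x.2‖ * ‖B x.2 x.1‖ := by
    simp only [Matrix.trace, Matrix.diag, Matrix.mul_apply]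
    rw [← Finset.sum_product', Finset.univ_product_univ]
    refine (norm_sum_le _ _).trans (Finset.sum_le_sum fun x _ => ?_)
    rw [norm_mul]
  calc ‖(A * B).trace‖ ^ 2 ≤ (∑ x : m × n, ‖A x.1 x.2‖ * ‖B x.2 x.1‖) ^ 2 := by gcongr
    _ ≤ (∑ x : m × n, ‖A x.1 x.2‖ ^ 2) * ∑ x : m × n, ‖B x.2 x.1‖ ^ 2 :=
      Finset.sum_mul_sq_le_sq_mul_sq _ _ _
    _ = frobSq A * frobSq B := by
      rw [← frobSq_transpose B]
      simp only [frobSq, Fintype.sum_prod_type, Matrix.transpose_apply]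

/-- Unitarity of a square matrix whose rows and columns may be indexed by different types. -/
def IsUnitary [DecidableEq m] [DecidableEq n] (U : Matrix m n ℂ) : Prop :=
  U.conjTranspose * U = 1 ∧ U * U.conjTranspose = 1

section Unitary

variable [DecidableEq l] [DecidableEq m] [DecidableEq n]

theorem IsUnitary.one : IsUnitary (1 : Matrix n n ℂ) := by simp [IsUnitary]

theorem IsUnitary.conjTranspose {U : Matrix m n ℂ} (hU : IsUnitary U) :
    IsUnitary U.conjTranspose := by
  simpa [IsUnitary] using hU.symm

theorem IsUnitary.transpose {U : Matrix m n ℂ} (hU : IsUnitary U) :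
    IsUnitary U.transpose := by
  constructor
  · rw [Matrix.conjTranspose, Matrix.transpose_map, ← Matrix.transpose_one, ← hU.2,
      Matrix.transpose_mul]
    rfl
  · rw [Matrix.conjTranspose, Matrix.transpose_map, ← Matrix.transpose_one, ← hU.1,
      Matrix.transpose_mul]
    rfl

theorem IsUnitary.mul {U : Matrix l m ℂ} {V : Matrix m n ℂ} (hU : IsUnitary U)
    (hV : IsUnitary V) : IsUnitary (U * V) := by
  constructor
  · rw [Matrix.conjTranspose_mul, Matrix.mul_assoc, ← Matrix.mul_assoc _ U, hU.1,
      Matrix.one_mul, hV.1]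
  · rw [Matrix.conjTranspose_mul, Matrix.mul_assoc, ← Matrix.mul_assoc V, hV.2,
      Matrix.one_mul, hU.2]

theorem IsUnitary.kronecker [DecidableEq p] {U : Matrix l m ℂ} {V : Matrix n p ℂ}
    (hU : IsUnitary U) (hV : IsUnitary V) : IsUnitary (U ⊗ₖ V) := by
  constructor
  · rw [Matrix.conjTranspose_kronecker, ← Matrix.mul_kronecker_mul, hU.1, hV.1,
      Matrix.one_kronecker_one]
  · rw [Matrix.conjTranspose_kronecker, ← Matrix.mul_kronecker_mul, hU.2, hV.2,
      Matrix.one_kronecker_one]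

theorem isUnitary_of_left {U : Matrix n n ℂ} (h : U.conjTranspose * U = 1) : IsUnitary U :=
  ⟨h, mul_eq_one_comm.mp h⟩

theorem frobSq_unitary_mul {U : Matrix m n ℂ} (hU : IsUnitary U) (A : Matrix n p ℂ) :
    frobSq (U * A) = frobSq A := by
  apply Complex.ofReal_injective
  rw [← trace_conjTranspose_mul_self_eq_frobSq, ← trace_conjTranspose_mul_self_eq_frobSq,
    Matrix.conjTranspose_mul, Matrix.mul_assoc, ← Matrix.mul_assoc _ U, hU.1, Matrix.one_mul]

theorem frobSq_mul_unitary {U : Matrix m n ℂ} (hU : IsUnitary U) (A : Matrix p m ℂ) :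
    frobSq (A * U) = frobSq A := by
  rw [← frobSq_transpose, Matrix.transpose_mul, frobSq_unitary_mul hU.transpose,
    frobSq_transpose]

/-- The singular value decomposition of an invertible matrix `Φ`.  The right factor diagonalizes
`Φᴴ Φ`, and its columns are sent by `Φ` to orthogonal vectors. -/
theorem exists_svd (Φ : Matrix n n ℂ) (h : Φ.det ≠ 0) :
    ∃ (U V : Matrix n n ℂ) (s : n → ℝ), IsUnitary U ∧ IsUnitary V ∧ (∀ i, 0 < s i) ∧
      Φ = U * Matrix.diagonal (fun i => (s i : ℂ)) * V.transpose := by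
  have hpd : (Φ.conjTranspose * Φ).PosDef := by
    apply Matrix.PosDef.conjTranspose_mul_self
    exact Matrix.mulVec_injective_of_isUnit ((Matrix.isUnit_iff_isUnit_det _).2 h.isUnit)
  set μ := hpd.1.eigenvalues with hμ
  have hμpos : ∀ i, 0 < μ i := fun i => hpd.eigenvalues_pos i
  set W : Matrix n n ℂ := (hpd.1.eigenvectorUnitary : Matrix n n ℂ) with hW
  have hWu : IsUnitary W :=
    isUnitary_of_left (Matrix.mem_unitaryGroup_iff'.1 hpd.1.eigenvectorUnitary.2)
  have hspec : Φ.conjTranspose * Φ =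
      W * Matrix.diagonal (fun i => (μ i : ℂ)) * W.conjTranspose := by
    have := hpd.1.spectral_theorem
    rw [Unitary.conjStarAlgAut_apply] at this
    exact this
  let r : n → ℝ := fun i => Real.sqrt (μ i)
  have hr : ∀ i, 0 < r i := fun i => Real.sqrt_pos.2 (hμpos i)
  let R : Matrix n n ℂ := Matrix.diagonal (fun i => ((r i)⁻¹ : ℂ))
  have hRR : R * Matrix.diagonal (fun i => (r i : ℂ)) = 1 := by
    rw [Matrix.diagonal_mul_diagonal, ← Matrix.diagonal_one]
    congr 1; funext i
    exact inv_mul_cancel₀ (by exact_mod_cast (hr i).ne')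
  refine ⟨Φ * W * R, W.conjTranspose.transpose, r, isUnitary_of_left ?_,
    hWu.conjTranspose.transpose, hr, ?_⟩
  · have e1 : (Φ * W * R).conjTranspose * (Φ * W * R) =
        R.conjTranspose * (W.conjTranspose * (Φ.conjTranspose * Φ) * W) * R := by
      simp only [Matrix.conjTranspose_mul, Matrix.mul_assoc]
    have e2 : W.conjTranspose * (Φ.conjTranspose * Φ) * W
        = Matrix.diagonal (fun i => (μ i : ℂ)) := by
      rw [hspec]
      simp only [Matrix.mul_assoc]
      rw [hWu.1, Matrix.mul_one, ← Matrix.mul_assoc, hWu.1, Matrix.one_mul]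
    rw [e1, e2, Matrix.diagonal_conjTranspose, Matrix.diagonal_mul_diagonal,
      Matrix.diagonal_mul_diagonal, ← Matrix.diagonal_one]
    congr 1; funext i
    have h0 : (r i : ℂ) ≠ 0 := by exact_mod_cast (hr i).ne'
    have h1 : (μ i : ℂ) = r i * r i := by
      exact_mod_cast (Real.mul_self_sqrt (hμpos i).le).symm
    simp only [Pi.star_apply, star_inv₀, Complex.star_def, Complex.conj_ofReal, h1]
    field_simp
  · rw [Matrix.transpose_transpose, Matrix.mul_assoc (Φ * W), hRR, Matrix.mul_one,
      Matrix.mul_assoc, hWu.2, Matrix.mul_one]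

end Unitary

end Matrices

/-! ### Cloning in matrix form -/

section MatrixCloning

variable {ι : Type*} {n n' : Type*} [Fintype n] [Fintype n']

/-- The data that a separable cloning operation leaves behind when a bipartite vector is read as
the matrix of its coordinates: Kraus operators `A m ⊗ B m` send `Ψ i ⊗ Φ` to multiples of
`Ψ i ⊗ Ψ i`, with outcome probabilities that add up to one.  Of the closure condition only the
trace is kept. -/
def MatrixClonable (Ψ : ι → Matrix n n ℂ) (Φ : Matrix n n ℂ) : Prop :=
  ∃ (M : ℕ) (A B : Fin M → Matrix (n × n) (n × n) ℂ) (c : ι → Fin M → ℂ),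
    ∑ m, frobSq (A m) * frobSq (B m) = (Fintype.card n : ℝ) ^ 4 ∧
    (∀ i m, A m * (Ψ i ⊗ₖ Φ) * (B m).transpose = c i m • (Ψ i ⊗ₖ Ψ i)) ∧
    ∀ i, ∑ m, ‖c i m‖ ^ 2 = 1

/-- Exchanging the two parties transposes all coordinate matrices. -/
theorem MatrixClonable.transpose {Ψ : ι → Matrix n n ℂ} {Φ : Matrix n n ℂ}
    (h : MatrixClonable Ψ Φ) : MatrixClonable (fun i => (Ψ i).transpose) Φ.transpose := by
  obtain ⟨M, A, B, c, h1, h2, h3⟩ := h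
  refine ⟨M, B, A, c, by simpa only [mul_comm] using h1, fun i m => ?_, h3⟩
  have := congrArg Matrix.transpose (h2 i m)
  rw [Matrix.transpose_mul, Matrix.transpose_mul, Matrix.transpose_transpose,
    Matrix.transpose_smul] at this
  rw [Matrix.mul_assoc]
  exact this

/-- Local changes of bases do not affect clonability; the blank state may be expressed in other
bases than the states to be cloned. -/
theorem MatrixClonable.unitary_equiv [DecidableEq n] [DecidableEq n']
    {Ψ : ι → Matrix n n ℂ} {Φ : Matrix n n ℂ} {Ψ' : ι → Matrix n' n' ℂ} {Φ' : Matrix n' n' ℂ}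
    {U V U₂ V₂ : Matrix n n' ℂ} (hU : IsUnitary U) (hV : IsUnitary V) (hU₂ : IsUnitary U₂)
    (hV₂ : IsUnitary V₂) (hcard : Fintype.card n = Fintype.card n')
    (hΨ : ∀ i, Ψ i = U * Ψ' i * V.transpose) (hΦ : Φ = U₂ * Φ' * V₂.transpose)
    (h : MatrixClonable Ψ Φ) : MatrixClonable Ψ' Φ' := by
  obtain ⟨M, A, B, c, h1, h2, h3⟩ := h
  refine ⟨M, fun m => (U ⊗ₖ U).conjTranspose * A m * (U ⊗ₖ U₂),
    fun m => (V ⊗ₖ V).conjTranspose * B m * (V ⊗ₖ V₂), c, ?_, fun i m => ?_, h3⟩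
  · rw [← hcard, ← h1]
    refine Finset.sum_congr rfl fun m _ => ?_
    rw [frobSq_mul_unitary (hU.kronecker hU₂), frobSq_mul_unitary (hV.kronecker hV₂),
      frobSq_unitary_mul (hU.kronecker hU).conjTranspose,
      frobSq_unitary_mul (hV.kronecker hV).conjTranspose]
  · have hV' : V.transpose * V.conjTranspose.transpose = 1 := by
      rw [← Matrix.transpose_mul, hV.1, Matrix.transpose_one]
    have e1 : U.conjTranspose * Ψ i * V.conjTranspose.transpose = Ψ' i := by
      rw [hΨ]
      simp only [Matrix.mul_assoc]
      rw [hV', Matrix.mul_one, ← Matrix.mul_assoc, hU.1, Matrix.one_mul]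
    calc (U ⊗ₖ U).conjTranspose * A m * (U ⊗ₖ U₂) * (Ψ' i ⊗ₖ Φ') *
          ((V ⊗ₖ V).conjTranspose * B m * (V ⊗ₖ V₂)).transpose
        = (U ⊗ₖ U).conjTranspose * (A m * (((U ⊗ₖ U₂) * (Ψ' i ⊗ₖ Φ')) *
          (V ⊗ₖ V₂).transpose) * (B m).transpose) * (V ⊗ₖ V).conjTranspose.transpose := by
          simp only [Matrix.transpose_mul, Matrix.mul_assoc]
      _ = (U ⊗ₖ U).conjTranspose * (c i m • (Ψ i ⊗ₖ Ψ i)) *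
          (V ⊗ₖ V).conjTranspose.transpose := by
          rw [← h2, ← Matrix.kroneckerMap_transpose, ← Matrix.mul_kronecker_mul,
            ← Matrix.mul_kronecker_mul, ← hΨ, ← hΦ]
      _ = c i m • (Ψ' i ⊗ₖ Ψ' i) := by
          rw [Matrix.conjTranspose_kronecker, Matrix.conjTranspose_kronecker,
            ← Matrix.kroneckerMap_transpose, Matrix.mul_smul, Matrix.smul_mul,
            ← Matrix.mul_kronecker_mul, ← Matrix.mul_kronecker_mul, e1]

end MatrixCloning

/-! ### Consequences of clonability for determinants and ratios of states -/

section Necessary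

variable {ι : Type*} {n : Type*} [Fintype n] [DecidableEq n]

theorem exists_ne_zero_of_sum_norm_sq {M : ℕ} {c : Fin M → ℂ} (h : ∑ m, ‖c m‖ ^ 2 = 1) :
    ∃ m, c m ≠ 0 := by
  by_contra! hc
  simp [hc] at h

/-- A blank state that allows cloning of a state of full Schmidt rank has full Schmidt rank. -/
theorem MatrixClonable.det_blank_ne_zero {Ψ : ι → Matrix n n ℂ} {Φ : Matrix n n ℂ}
    (h : MatrixClonable Ψ Φ) (i : ι) (hi : (Ψ i).det ≠ 0) : Φ.det ≠ 0 := by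
  obtain ⟨M, A, B, c, -, h2, h3⟩ := h
  obtain ⟨m, hm⟩ := exists_ne_zero_of_sum_norm_sq (h3 i)
  intro hΦ
  by_cases hn : Fintype.card n = 0
  · have := Fintype.card_eq_zero_iff.1 hn
    simp at hΦ
  have := congrArg Matrix.det (h2 i m)
  rw [Matrix.det_mul, Matrix.det_mul, Matrix.det_kronecker, Matrix.det_smul,
    Matrix.det_kronecker, hΦ, zero_pow hn] at this
  simp [hm, hi] at this

/-- Clonable states have the same `G`-concurrence: the probabilities of each outcome for different
states are in a ratio fixed by the determinants, and the probabilities add up to one. -/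
theorem MatrixClonable.norm_det_eq [Nonempty n] {Ψ : ι → Matrix n n ℂ} {Φ : Matrix n n ℂ}
    (h : MatrixClonable Ψ Φ) (hΨ : ∀ i, (Ψ i).det ≠ 0) (i j : ι) :
    ‖(Ψ i).det‖ = ‖(Ψ j).det‖ := by
  obtain ⟨M, A, B, c, -, h2, h3⟩ := h
  set N := Fintype.card n with hN
  have hN0 : N ≠ 0 := Fintype.card_ne_zero
  have key : ∀ i m, ‖(A m).det‖ * ‖Φ.det‖ ^ N * ‖(B m).det‖ =
      (‖c i m‖ ^ N * ‖(Ψ i).det‖) ^ N := by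
    intro i m
    have := congrArg (fun X => ‖Matrix.det X‖) (h2 i m)
    simp only [Matrix.det_mul, Matrix.det_kronecker, Matrix.det_smul, Matrix.det_transpose,
      norm_mul, norm_pow, Fintype.card_prod, ← hN] at this
    have hpos : ‖(Ψ i).det‖ ^ N ≠ 0 := pow_ne_zero _ (norm_ne_zero_iff.2 (hΨ i))
    apply mul_right_cancel₀ hpos
    calc _ = ‖(A m).det‖ * (‖(Ψ i).det‖ ^ N * ‖Φ.det‖ ^ N) * ‖(B m).det‖ := by ring
      _ = _ := this
      _ = _ := by ring
  have key2 : ∀ m, ‖c i m‖ ^ N * ‖(Ψ i).det‖ = ‖c j m‖ ^ N * ‖(Ψ j).det‖ := by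
    intro m
    refine (pow_left_inj₀ (by positivity) (by positivity) hN0).1 ?_
    rw [← key, ← key]
  -- A strictly smaller determinant would force every nonzero outcome probability to be strictly
  -- larger, while both families of probabilities add up to one.
  have aux : ∀ i j, (∀ m, ‖c i m‖ ^ N * ‖(Ψ i).det‖ = ‖c j m‖ ^ N * ‖(Ψ j).det‖) →
      ¬ ‖(Ψ i).det‖ < ‖(Ψ j).det‖ := by
    intro i j hij hlt
    obtain ⟨m₀, hm₀⟩ := exists_ne_zero_of_sum_norm_sq (h3 j)
    have hstep : ∀ m, c j m ≠ 0 → ‖c j m‖ < ‖c i m‖ := by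
      intro m hm
      by_contra! hle
      have h5 : ‖c i m‖ ^ N ≤ ‖c j m‖ ^ N := by gcongr
      have h6 : 0 < ‖c j m‖ ^ N := by positivity
      have h7 := hij m
      have h8 : ‖c i m‖ ^ N * ‖(Ψ i).det‖ ≤ ‖c j m‖ ^ N * ‖(Ψ i).det‖ := by gcongr
      have h9 : ‖c j m‖ ^ N * ‖(Ψ i).det‖ < ‖c j m‖ ^ N * ‖(Ψ j).det‖ := by gcongr
      linarith
    have : ∑ m, ‖c j m‖ ^ 2 < ∑ m, ‖c i m‖ ^ 2 := by
      refine Finset.sum_lt_sum (fun m _ => ?_) ⟨m₀, Finset.mem_univ _, ?_⟩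
      · by_cases hm : c j m = 0
        · rw [hm]; simp
        · have := (hstep m hm).le
          gcongr
      · have := hstep m₀ hm₀
        gcongr
    rw [h3, h3] at this
    exact lt_irrefl _ this
  exact le_antisymm (not_lt.1 (aux j i fun m => (key2 m).symm)) (not_lt.1 (aux i j key2))

/-- The Kraus operator on the first side intertwines `T ⊗ 1` with a multiple of `T ⊗ T`, where `T`
carries one of the states into the other. -/
theorem kraus_intertwines {A B : Matrix (n × n) (n × n) ℂ} {Ψ Φ T : Matrix n n ℂ} {c c' : ℂ}
    (hc : c ≠ 0) (hΨ : Ψ.det ≠ 0) (h : A * (Ψ ⊗ₖ Φ) * B.transpose = c • (Ψ ⊗ₖ Ψ))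
    (h' : A * ((T * Ψ) ⊗ₖ Φ) * B.transpose = c' • ((T * Ψ) ⊗ₖ (T * Ψ))) :
    A * (T ⊗ₖ (1 : Matrix n n ℂ)) = (c' / c) • ((T ⊗ₖ T) * A) := by
  set X := (Ψ ⊗ₖ Φ) * B.transpose with hX
  rw [Matrix.mul_assoc, ← hX] at h
  have hXu : IsUnit X := by
    rw [Matrix.isUnit_iff_isUnit_det, isUnit_iff_ne_zero]
    intro h0
    have := congrArg Matrix.det h
    rw [Matrix.det_mul, h0, Matrix.det_smul, Matrix.det_kronecker] at this
    simp [hc, hΨ] at this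
  refine hXu.mul_right_cancel ?_
  calc A * (T ⊗ₖ (1 : Matrix n n ℂ)) * X
      = A * (((T ⊗ₖ (1 : Matrix n n ℂ)) * (Ψ ⊗ₖ Φ)) * B.transpose) := by
        rw [hX]; simp only [Matrix.mul_assoc]
    _ = c' • ((T ⊗ₖ T) * (Ψ ⊗ₖ Ψ)) := by
        rw [← Matrix.mul_kronecker_mul, Matrix.one_mul, ← Matrix.mul_assoc, h',
          Matrix.mul_kronecker_mul]
    _ = (c' / c) • ((T ⊗ₖ T) * (c • (Ψ ⊗ₖ Ψ))) := by
        rw [Matrix.mul_smul, smul_smul, div_mul_cancel₀ _ hc]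
    _ = (c' / c) • ((T ⊗ₖ T) * A) * X := by
        rw [← h, Matrix.smul_mul, Matrix.mul_assoc]

end Necessary

/-! ### Group-shifted states force a maximally entangled blank -/

section Shifts

variable {G : Type*} [Group G] [Fintype G] [DecidableEq G]

theorem add_le_of_cyclic_products {a b c : ℝ} (ha : 0 < a) (hb : 0 < b) (hc : 0 < c) :
    a + b + c ≤ a * b / c + b * c / a + c * a / b := by
  have : a * b / c + b * c / a + c * a / b - (a + b + c) =
      ((a * b - b * c) ^ 2 + (b * c - c * a) ^ 2 + (c * a - a * b) ^ 2) / (2 * (a * b * c)) := by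
    field_simp
    ring
  have h2 : 0 ≤ ((a * b - b * c) ^ 2 + (b * c - c * a) ^ 2 + (c * a - a * b) ^ 2) /
      (2 * (a * b * c)) := by positivity
  linarith

/-- The rearrangement inequality behind the necessity of a maximally entangled blank.  It is
special to groups with at most three elements, where three shifts can only be pairwise distinct
if they exhaust the group. -/
theorem sum_le_sum_shifted_ratio (hG : Fintype.card G ≤ 3) {l : G → ℝ} (hl : ∀ g, 0 < l g)
    (g h k : G) : ∑ x, l x ≤ ∑ f, l (f * g) * l (f * h) / l (f * k) := by
  have shift : ∀ (F : G → ℝ) (y : G), ∑ f, F (f * y) = ∑ x, F x := fun F y =>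
    Equiv.sum_comp (Equiv.mulRight y) F
  by_cases hgk : g = k
  · subst hgk
    rw [← shift l h]
    refine Finset.sum_le_sum fun f _ => ?_
    rw [mul_div_right_comm, div_self (hl _).ne', one_mul]
  by_cases hhk : h = k
  · subst hhk
    rw [← shift l g]
    refine Finset.sum_le_sum fun f _ => ?_
    rw [mul_div_assoc, div_self (hl _).ne', mul_one]
  by_cases hgh : g = h
  · subst hgh
    -- The tangent bound `2 a - b ≤ a² / b`, summed over the group.
    have h1 : ∀ f, 2 * l (f * g) - l (f * k) ≤ l (f * g) * l (f * g) / l (f * k) := by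
      intro f
      rw [le_div_iff₀ (hl _)]
      nlinarith [sq_nonneg (l (f * g) - l (f * k))]
    refine le_trans (le_of_eq ?_) (Finset.sum_le_sum fun f _ => h1 f)
    rw [Finset.sum_sub_distrib, ← Finset.mul_sum, shift l g, shift l k]
    ring
  · have huniv : ∀ f, ({f * g, f * h, f * k} : Finset G) = Finset.univ := by
      intro f
      refine Finset.eq_univ_of_card _ (le_antisymm (Finset.card_le_univ _) ?_)
      rw [Finset.card_eq_three.2 ⟨f * g, f * h, f * k, by simpa, by simpa, by simpa, rfl⟩]
      exact hG
    have h3 : ∀ (F : G → ℝ), ∑ x, F x = F g + F h + F k := by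
      intro F
      rw [← huniv 1, Finset.sum_insert (by simp [hgh, hgk]), Finset.sum_insert (by simp [hhk]),
        Finset.sum_singleton]
      simp [add_assoc]
    have hprod : ∀ f, l (f * g) * l (f * h) * l (f * k) = ∏ x, l x := by
      intro f
      rw [← huniv f, Finset.prod_insert (by simp [hgh, hgk]), Finset.prod_insert (by simp [hhk]),
        Finset.prod_singleton, mul_assoc]
    have hterm : ∀ f, l (f * g) * l (f * h) / l (f * k) = (∏ x, l x) / l (f * k) ^ 2 := by
      intro f
      rw [← hprod f]
      have := (hl (f * k)).ne'
      field_simp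
    rw [Finset.sum_congr rfl fun f _ => hterm f, shift (fun x => (∏ x, l x) / l x ^ 2) k,
      h3, h3, ← hprod 1]
    simp only [one_mul]
    refine (add_le_of_cyclic_products (hl g) (hl h) (hl k)).trans (le_of_eq ?_)
    have h4 := (hl g).ne'
    have h5 := (hl h).ne'
    have h6 := (hl k).ne'
    field_simp
    ring

/-- The matrix that sends the basis vector `g` to `w g` times the basis vector `f * g`. -/
def shiftMatrix (f : G) (w : G → ℂ) : Matrix G G ℂ :=
  Matrix.of fun x g => if x = f * g then w g else 0

theorem shiftMatrix_mul_diagonal (f : G) (w d : G → ℂ) :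
    shiftMatrix f w * Matrix.diagonal d = shiftMatrix f (fun g => w g * d g) := by
  ext x g
  simp [shiftMatrix, Matrix.mul_diagonal]

theorem shiftMatrix_one {G : Type*} [Group G] [DecidableEq G] (w : G → ℂ) :
    shiftMatrix 1 w = Matrix.diagonal w := by
  ext x g
  by_cases h : x = g <;> simp [shiftMatrix, h]

theorem isUnitary_shiftMatrix (f : G) {w : G → ℂ} (hw : ∀ g, ‖w g‖ = 1) :
    IsUnitary (shiftMatrix f w) := by
  refine isUnitary_of_left ?_
  ext g h
  by_cases hgh : g = h
  · subst hgh
    simp only [shiftMatrix, Matrix.mul_apply, Matrix.conjTranspose_apply, Matrix.of_apply,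
      Matrix.one_apply_eq, mul_ite, mul_zero]
    simp [Complex.conj_mul', hw]
  · simp only [shiftMatrix, Matrix.mul_apply, Matrix.conjTranspose_apply, Matrix.of_apply,
      Matrix.one_apply_ne hgh, mul_ite, mul_zero]
    simp [Ne.symm hgh]

/-- A Kraus operator that clones group-shifted states with a blank of singular values `s` is
bounded below in Hilbert–Schmidt norm.  The matrix `Y` in the proof is, up to a factor, the
inverse of `A`; the moduli of its entries are invariant under simultaneous shifts, so that the
weights coming from the Schmidt coefficients can be averaged over the group. -/
theorem kraus_frobSq_lower_bound (hG : Fintype.card G ≤ 3) {l : G → ℝ} (hl : ∀ g, 0 < l g)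
    (hsum : ∑ g, l g = 1) {w : G → G → ℂ} (hw : ∀ f g, ‖w f g‖ ^ 2 = l g) {s : G → ℝ}
    (hs : ∀ g, 0 < s g) {A B : Matrix (G × G) (G × G) ℂ} {c : G → ℂ}
    (h : ∀ f, A * (shiftMatrix f (w f) ⊗ₖ Matrix.diagonal (fun i => (s i : ℂ))) * B.transpose =
      c f • (shiftMatrix f (w f) ⊗ₖ shiftMatrix f (w f))) :
    ‖c 1‖ ^ 2 * (Fintype.card G * (∑ g, (s g)⁻¹) ^ 2) ≤ frobSq A * frobSq B := by
  by_cases hc : c 1 = 0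
  · rw [hc, norm_zero]
    have := mul_nonneg (frobSq_nonneg A) (frobSq_nonneg B)
    simpa using this
  set N : ℝ := (Fintype.card G : ℝ) with hN
  have hNpos : 0 < N := by
    rw [hN]; exact_mod_cast Fintype.card_pos
  have hw0 : ∀ f g, w f g ≠ 0 := by
    intro f g h0
    have := hw f g
    rw [h0] at this
    simp at this
    exact (hl g).ne this
  set d : G → ℂ := w 1 with hd
  have hd0 : ∀ g, d g ≠ 0 := hw0 1
  have hdet : (shiftMatrix 1 (w 1)).det ≠ 0 := by
    rw [shiftMatrix_one, Matrix.det_diagonal]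
    exact Finset.prod_ne_zero_iff.2 fun g _ => hd0 g
  let t : G → G → ℂ := fun f g => w f g / d g
  have ht : ∀ f g, ‖t f g‖ = 1 := by
    intro f g
    have h1 : ‖w f g‖ = ‖d g‖ := by
      refine (sq_eq_sq₀ (norm_nonneg _) (norm_nonneg _)).1 ?_
      rw [hw, hd, hw]
    rw [norm_div, h1, div_self (norm_ne_zero_iff.2 (hd0 g))]
  let T : G → Matrix G G ℂ := fun f => shiftMatrix f (t f)
  have hT : ∀ f, T f * shiftMatrix 1 (w 1) = shiftMatrix f (w f) := by
    intro f
    rw [shiftMatrix_one, shiftMatrix_mul_diagonal]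
    congr 1; funext g
    exact div_mul_cancel₀ _ (hd0 g)
  have hint : ∀ f, A * (T f ⊗ₖ (1 : Matrix G G ℂ)) = (c f / c 1) • ((T f ⊗ₖ T f) * A) := by
    intro f
    refine kraus_intertwines hc hdet (h 1) ?_
    rw [hT]
    exact h f
  let Q : Matrix (G × G) (G × G) ℂ := Matrix.diagonal fun p => (d p.1 * d p.2)⁻¹
  have hQ : (shiftMatrix 1 (w 1) ⊗ₖ shiftMatrix 1 (w 1)) * Q = 1 := by
    rw [shiftMatrix_one, Matrix.diagonal_kronecker_diagonal, Matrix.diagonal_mul_diagonal,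
      ← Matrix.diagonal_one]
    congr 1; funext p
    exact mul_inv_cancel₀ (mul_ne_zero (hd0 _) (hd0 _))
  let Y : Matrix (G × G) (G × G) ℂ :=
    (shiftMatrix 1 (w 1) ⊗ₖ Matrix.diagonal (fun i => (s i : ℂ))) * B.transpose * Q
  have hAY : A * Y = c 1 • 1 := by
    rw [← hQ, ← Matrix.smul_mul, ← h 1]
    simp only [Y, Matrix.mul_assoc]
  have hYA : Y * A = c 1 • 1 := by
    have h1 : (c 1)⁻¹ • A * Y = 1 := by
      rw [Matrix.smul_mul, hAY, smul_smul, inv_mul_cancel₀ hc, one_smul]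
    have h2 := mul_eq_one_comm.1 h1
    rw [← h2, Matrix.mul_smul, smul_smul, mul_inv_cancel₀ hc, one_smul]
  have hY0 : Y ≠ 0 := by
    intro h0
    have := congrFun (congrFun hAY (1, 1)) (1, 1)
    rw [h0, Matrix.mul_zero] at this
    simp at this
    exact hc this.symm
  have hYint : ∀ f, (T f ⊗ₖ (1 : Matrix G G ℂ)) * Y = (c f / c 1) • (Y * (T f ⊗ₖ T f)) := by
    intro f
    have h1 : Y * (A * (T f ⊗ₖ (1 : Matrix G G ℂ))) * Y =
        Y * ((c f / c 1) • ((T f ⊗ₖ T f) * A)) * Y := by rw [hint]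
    rw [← Matrix.mul_assoc Y A, hYA, Matrix.mul_smul, Matrix.smul_mul, Matrix.smul_mul,
      Matrix.one_mul, Matrix.smul_mul, Matrix.mul_assoc Y, Matrix.mul_assoc _ A, hAY,
      Matrix.mul_smul, Matrix.mul_one, Matrix.mul_smul, smul_comm] at h1
    have h2 := congrArg (fun X => (c 1)⁻¹ • X) h1
    simp only [smul_smul, inv_mul_cancel₀ hc, one_smul] at h2
    simpa only [← mul_assoc, inv_mul_cancel₀ hc, one_mul, one_smul] using h2
  have hTu : ∀ f, IsUnitary (T f) := fun f => isUnitary_shiftMatrix f (ht f)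
  have hratio : ∀ f, ‖c f / c 1‖ = 1 := by
    intro f
    have h1 := congrArg frobSq (hYint f)
    rw [frobSq_unitary_mul ((hTu f).kronecker .one), frobSq_smul,
      frobSq_mul_unitary ((hTu f).kronecker (hTu f))] at h1
    have h2 : ‖c f / c 1‖ ^ 2 = 1 := by
      have := frobSq_pos hY0
      exact mul_right_cancel₀ this.ne' (by rw [← h1, one_mul])
    exact (pow_eq_one_iff_of_nonneg (norm_nonneg _) two_ne_zero).1 h2
  have hYinv : ∀ f g h x y, ‖Y (f * g, h) (f * x, f * y)‖ = ‖Y (g, h) (x, y)‖ := by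
    intro f g h x y
    have e1 : ((T f ⊗ₖ (1 : Matrix G G ℂ)) * Y) (f * g, h) (x, y) = t f g * Y (g, h) (x, y) := by
      simp [Matrix.mul_apply, Fintype.sum_prod_type, T, shiftMatrix, Matrix.one_apply]
    have e2 : (Y * (T f ⊗ₖ T f)) (f * g, h) (x, y) =
        Y (f * g, h) (f * x, f * y) * (t f x * t f y) := by
      simp [Matrix.mul_apply, Fintype.sum_prod_type, T, shiftMatrix]
    have e3 := congrArg norm (congrFun (congrFun (hYint f) (f * g, h)) (x, y))
    rw [e1, Matrix.smul_apply, e2, smul_eq_mul] at e3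
    simpa only [norm_mul, ht, hratio, one_mul, mul_one] using e3.symm
  let δ : G → G → G → G → ℝ := fun g h x y => ‖Y (g, h) (x, y)‖ ^ 2 / s h ^ 2
  have hδ0 : ∀ g h x y, 0 ≤ δ g h x y := fun g h x y => by positivity
  have hB : ∀ g h x y, ‖B (x, y) (g, h)‖ ^ 2 = l x * l y / l g * δ g h x y := by
    intro g h x y
    have e1 : Y (g, h) (x, y) = d g * s h * B (x, y) (g, h) * (d x * d y)⁻¹ := by
      simp only [Y, Q, shiftMatrix_one, Matrix.diagonal_kronecker_diagonal,
        Matrix.mul_diagonal, Matrix.diagonal_mul, Matrix.transpose_apply]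
      rfl
    have e2 : ‖Y (g, h) (x, y)‖ ^ 2 = l g * s h ^ 2 * ‖B (x, y) (g, h)‖ ^ 2 / (l x * l y) := by
      rw [e1, norm_mul, norm_mul, norm_mul, norm_inv, norm_mul, mul_pow, mul_pow, mul_pow,
        inv_pow, mul_pow, hd, hw, hw, hw, Complex.norm_real, Real.norm_eq_abs, sq_abs]
      rfl
    simp only [δ, e2]
    have := (hl g).ne'
    have := (hl x).ne'
    have := (hl y).ne'
    have := (hs h).ne'
    field_simp
  have hfrobB : frobSq B = ∑ g, ∑ h, ∑ x, ∑ y, l x * l y / l g * δ g h x y := by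
    rw [← frobSq_transpose]
    simp only [frobSq, Fintype.sum_prod_type, Matrix.transpose_apply, hB]
  have havg : ∑ g, ∑ h, ∑ x, ∑ y, δ g h x y ≤ N * frobSq B := by
    have e1 : ∀ f, frobSq B = ∑ g, ∑ h, ∑ x, ∑ y,
        l (f * x) * l (f * y) / l (f * g) * δ g h x y := by
      intro f
      rw [hfrobB, ← Equiv.sum_comp (Equiv.mulLeft f)]
      refine Finset.sum_congr rfl fun g _ => Finset.sum_congr rfl fun h _ => ?_
      rw [← Equiv.sum_comp (Equiv.mulLeft f)]
      refine Finset.sum_congr rfl fun x _ => ?_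
      rw [← Equiv.sum_comp (Equiv.mulLeft f)]
      refine Finset.sum_congr rfl fun y _ => ?_
      simp only [Equiv.coe_mulLeft, δ, hYinv]
    have e2 : N * frobSq B = ∑ f : G, frobSq B := by
      rw [Finset.sum_const, Finset.card_univ, nsmul_eq_mul]
    rw [e2, Finset.sum_congr rfl fun f _ => e1 f]
    refine le_trans ?_ (le_of_eq Finset.sum_comm)
    refine Finset.sum_le_sum fun g _ => ?_
    refine le_trans ?_ (le_of_eq Finset.sum_comm)
    refine Finset.sum_le_sum fun h _ => ?_
    refine le_trans ?_ (le_of_eq Finset.sum_comm)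
    refine Finset.sum_le_sum fun x _ => ?_
    refine le_trans ?_ (le_of_eq Finset.sum_comm)
    refine Finset.sum_le_sum fun y _ => ?_
    rw [← Finset.sum_mul]
    refine le_mul_of_one_le_left (hδ0 g h x y) ?_
    rw [← hsum]
    exact sum_le_sum_shifted_ratio hG hl x y g
  let R : Matrix (G × G) (G × G) ℂ :=
    (1 : Matrix G G ℂ) ⊗ₖ Matrix.diagonal fun h => ((s h)⁻¹ : ℂ)
  have hRY : frobSq (R * Y) = ∑ g, ∑ h, ∑ x, ∑ y, δ g h x y := by
    simp only [R, ← Matrix.diagonal_one, Matrix.diagonal_kronecker_diagonal, frobSq,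
      Fintype.sum_prod_type, Matrix.diagonal_mul, δ, one_mul, norm_mul, norm_inv,
      Complex.norm_real, Real.norm_eq_abs, mul_pow, inv_pow, sq_abs]
    simp only [div_eq_inv_mul]
  have htr : (R * Y * A).trace = c 1 * (N * ∑ h, ((s h)⁻¹ : ℂ)) := by
    rw [Matrix.mul_assoc, hYA, Matrix.mul_smul, Matrix.mul_one, Matrix.trace_smul,
      Matrix.trace_kronecker, Matrix.trace_one, Matrix.trace_diagonal, smul_eq_mul, hN]
    norm_cast
  have hCS := norm_trace_mul_sq_le (R * Y) A
  have hnorm : ‖c 1 * (N * ∑ h, ((s h)⁻¹ : ℂ))‖ ^ 2 =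
      ‖c 1‖ ^ 2 * (N ^ 2 * (∑ h, (s h)⁻¹) ^ 2) := by
    have : (N * ∑ h, ((s h)⁻¹ : ℂ)) = ((N * ∑ h, (s h)⁻¹ : ℝ) : ℂ) := by push_cast; rfl
    rw [this, norm_mul, Complex.norm_real, Real.norm_eq_abs, mul_pow, sq_abs, mul_pow]
  rw [htr, hnorm, hRY] at hCS
  have h9 : ‖c 1‖ ^ 2 * (N ^ 2 * (∑ h, (s h)⁻¹) ^ 2) ≤ N * frobSq B * frobSq A :=
    hCS.trans (by gcongr; exact frobSq_nonneg A)
  have h10 : N * (‖c 1‖ ^ 2 * (N * (∑ g, (s g)⁻¹) ^ 2)) ≤ N * (frobSq A * frobSq B) := by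
    nlinarith
  exact le_of_mul_le_mul_left h10 hNpos

/-- Among normalized positive vectors, the sum of the inverses is smallest exactly for the
constant one. -/
theorem eq_const_of_sum_inv_le {κ : Type*} [Fintype κ] [Nonempty κ] {s : κ → ℝ}
    (hs : ∀ k, 0 < s k) (h1 : ∑ k, s k ^ 2 = 1)
    (h2 : (∑ k, (s k)⁻¹) ^ 2 ≤ (Fintype.card κ : ℝ) ^ 3) (k : κ) :
    s k = (Real.sqrt (Fintype.card κ))⁻¹ := by
  set N : ℝ := (Fintype.card κ : ℝ) with hN
  have hNpos : 0 < N := by rw [hN]; exact_mod_cast Fintype.card_pos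
  set r := Real.sqrt N with hr
  have hrpos : 0 < r := Real.sqrt_pos.2 hNpos
  have hrr : r ^ 2 = N := Real.sq_sqrt hNpos.le
  -- The tangent bound `(3 - t²) / 2 ≤ 1 / t` at `t = r * s k`.
  have hgap : ∀ k, (s k)⁻¹ - r * (3 - N * s k ^ 2) / 2 =
      (r * s k - 1) ^ 2 * (r * s k + 2) / (2 * s k) := by
    intro k
    have := (hs k).ne'
    rw [← hrr]
    field_simp
    ring
  have hnn : ∀ k, 0 ≤ (r * s k - 1) ^ 2 * (r * s k + 2) / (2 * s k) := by
    intro k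
    have := hs k
    positivity
  have hle : ∑ k, (s k)⁻¹ ≤ N * r := by
    refine le_of_sq_le_sq ?_ (by positivity)
    calc _ ≤ N ^ 3 := h2
      _ = (N * r) ^ 2 := by rw [mul_pow, hrr]; ring
  have hsum : ∑ k, r * (3 - N * s k ^ 2) / 2 = N * r := by
    rw [← Finset.sum_div, ← Finset.mul_sum, Finset.sum_sub_distrib, ← Finset.mul_sum, h1,
      Finset.sum_const, Finset.card_univ, nsmul_eq_mul, ← hN]
    ring
  have hzero : ∑ k, (r * s k - 1) ^ 2 * (r * s k + 2) / (2 * s k) ≤ 0 := by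
    rw [← Finset.sum_congr rfl fun k _ => hgap k, Finset.sum_sub_distrib, hsum]
    linarith
  have hk := (Finset.sum_eq_zero_iff_of_nonneg fun k _ => hnn k).1
    (le_antisymm hzero (Finset.sum_nonneg fun k _ => hnn k)) k (Finset.mem_univ k)
  have h3 := hs k
  have h4 : (r * s k - 1) ^ 2 = 0 := by
    rcases div_eq_zero_iff.1 hk with h | h
    · rcases mul_eq_zero.1 h with h | h
      · exact h
      · exfalso
        have : 0 < r * s k := by positivity
        linarith
    · linarith
  have h5 : r * s k = 1 := by linarith [pow_eq_zero_iff two_ne_zero |>.1 h4]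
  exact eq_inv_of_mul_eq_one_right h5

theorem frobSq_diagonal {κ : Type*} [Fintype κ] [DecidableEq κ] (d : κ → ℂ) :
    frobSq (Matrix.diagonal d) = ∑ k, ‖d k‖ ^ 2 := by
  refine Finset.sum_congr rfl fun i _ => ?_
  rw [Finset.sum_eq_single i]
  · simp
  · intro j _ hj
    simp [Matrix.diagonal_apply_ne' _ hj]
  · simp

/-- A normalized blank that allows cloning of shifted states, for a group with at most three
elements, is a multiple of a unitary matrix. -/
theorem MatrixClonable.blank_unitary (hG : Fintype.card G ≤ 3) {l : G → ℝ} (hl : ∀ g, 0 < l g)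
    (hsum : ∑ g, l g = 1) {w : G → G → ℂ} (hw : ∀ f g, ‖w f g‖ ^ 2 = l g) {Φ : Matrix G G ℂ}
    (hΦ : frobSq Φ = 1) (h : MatrixClonable (fun f => shiftMatrix f (w f)) Φ) :
    ∃ W, IsUnitary W ∧ Φ = ((Real.sqrt (Fintype.card G))⁻¹ : ℂ) • W := by
  have hdet : (shiftMatrix 1 (w 1)).det ≠ 0 := by
    rw [shiftMatrix_one, Matrix.det_diagonal]
    refine Finset.prod_ne_zero_iff.2 fun g _ h0 => ?_
    have := hw 1 g
    rw [h0] at this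
    simp at this
    exact (hl g).ne this
  obtain ⟨U, V, s, hU, hV, hs, hsvd⟩ := exists_svd Φ (h.det_blank_ne_zero 1 hdet)
  have h' : MatrixClonable (fun f => shiftMatrix f (w f))
      (Matrix.diagonal fun i => (s i : ℂ)) :=
    h.unitary_equiv .one .one hU hV rfl (fun f => by simp) hsvd
  have hs1 : ∑ k, s k ^ 2 = 1 := by
    rw [hsvd, frobSq_mul_unitary hV.transpose, frobSq_unitary_mul hU, frobSq_diagonal] at hΦ
    simpa using hΦ
  obtain ⟨M, A, B, c, h1, h2, h3⟩ := h'
  set N : ℝ := (Fintype.card G : ℝ) with hN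
  have hNpos : 0 < N := by rw [hN]; exact_mod_cast Fintype.card_pos
  have hle : N * (∑ g, (s g)⁻¹) ^ 2 ≤ N ^ 4 := by
    calc N * (∑ g, (s g)⁻¹) ^ 2 = ∑ m, ‖c 1 m‖ ^ 2 * (N * (∑ g, (s g)⁻¹) ^ 2) := by
          rw [← Finset.sum_mul, h3, one_mul]
      _ ≤ ∑ m, frobSq (A m) * frobSq (B m) := Finset.sum_le_sum fun m _ =>
          kraus_frobSq_lower_bound hG hl hsum hw hs (c := fun f => c f m) fun f => h2 f m
      _ = N ^ 4 := h1
  have hle' : (∑ g, (s g)⁻¹) ^ 2 ≤ N ^ 3 := by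
    refine le_of_mul_le_mul_left (hle.trans (le_of_eq ?_)) hNpos
    ring
  have hs2 := eq_const_of_sum_inv_le hs hs1 hle'
  refine ⟨U * V.transpose, hU.mul hV.transpose, ?_⟩
  rw [hsvd]
  have : (Matrix.diagonal fun i => (s i : ℂ)) = ((Real.sqrt N)⁻¹ : ℂ) • (1 : Matrix G G ℂ) := by
    rw [← Matrix.diagonal_one, ← Matrix.diagonal_smul]
    congr 1; funext i
    simp [hs2 i, hN]
  rw [this, Matrix.mul_smul, Matrix.mul_one, Matrix.smul_mul]

end Shifts

/-! ### Coordinate matrices of bipartite states -/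

section Coordinates

variable {D : ℕ}

/-- The coordinates of a bipartite vector, arranged as a matrix: rows belong to the first party,
columns to the second. -/
def ketMatrix (ψ : Ket D) : Matrix (Fin D) (Fin D) ℂ := Matrix.of fun i j => ψ (i, j)

theorem ketMatrix_injective : Function.Injective (ketMatrix (D := D)) := by
  intro ψ χ h
  ext p
  exact congrFun (congrFun h p.1) p.2

theorem frobSq_ketMatrix (ψ : Ket D) : frobSq (ketMatrix ψ) = ‖ψ‖ ^ 2 := by
  rw [EuclideanSpace.norm_sq_eq, Fintype.sum_prod_type]
  rfl

theorem ketMatrix_smul (c : ℂ) (ψ : Ket D) : ketMatrix (c • ψ) = c • ketMatrix ψ := rfl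

theorem ketMatrix_sum_apply {κ : Type*} [Fintype κ] (w : κ → ℂ)
    (x y : κ → EuclideanSpace ℂ (Fin D)) (i j : Fin D) :
    ketMatrix (∑ k, w k • prodKet (x k) (y k)) i j = ∑ k, w k * (x k i * y k j) := by
  simp [ketMatrix, prodKet]

/-- The matrix whose columns are the vectors of an orthonormal basis. -/
noncomputable def basisMatrix {κ : Type*} [Fintype κ]
    (u : OrthonormalBasis κ ℂ (EuclideanSpace ℂ (Fin D))) : Matrix (Fin D) κ ℂ :=
  Matrix.of fun i k => u k i

theorem isUnitary_basisMatrix {κ : Type*} [Fintype κ] [DecidableEq κ]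
    (u : OrthonormalBasis κ ℂ (EuclideanSpace ℂ (Fin D))) : IsUnitary (basisMatrix u) := by
  have h1 : (basisMatrix u).conjTranspose * basisMatrix u = 1 := by
    ext k l
    have := orthonormal_iff_ite.1 u.orthonormal k l
    rw [EuclideanSpace.inner_eq_star_dotProduct, dotProduct_comm] at this
    rw [Matrix.one_apply, ← this]
    rfl
  have hcard : Fintype.card κ = Fintype.card (Fin D) := by
    rw [Fintype.card_fin, ← Module.finrank_eq_card_basis u.toBasis, finrank_euclideanSpace_fin]
  exact ⟨h1, (Matrix.mul_eq_one_comm_of_card_eq κ (Fin D) ℂ hcard).1 h1⟩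

theorem exists_orthonormalBasis_of_isUnitary {U : Matrix (Fin D) (Fin D) ℂ} (hU : IsUnitary U) :
    ∃ u : OrthonormalBasis (Fin D) ℂ (EuclideanSpace ℂ (Fin D)), ∀ k i, u k i = U i k := by
  have hon : Orthonormal ℂ
      (fun k => (WithLp.toLp 2 (fun i => U i k) : EuclideanSpace ℂ (Fin D))) := by
    rw [orthonormal_iff_ite]
    intro k l
    rw [EuclideanSpace.inner_eq_star_dotProduct, dotProduct_comm, ← Matrix.one_apply, ← hU.1]
    rfl
  refine ⟨OrthonormalBasis.mk hon ?_, fun k i => ?_⟩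
  · rw [hon.linearIndependent.span_eq_top_of_card_eq_finrank' (by simp)]
  · rw [OrthonormalBasis.coe_mk]

/-- The coordinate matrix of a state whose Schmidt decomposition is shifted on the second side. -/
theorem ketMatrix_sum_shift {G : Type*} [Group G] [Fintype G] [DecidableEq G] (w : G → ℂ)
    (u v : OrthonormalBasis G ℂ (EuclideanSpace ℂ (Fin D))) (f : G) :
    ketMatrix (∑ g, w g • prodKet (u g) (v (f * g))) =
      basisMatrix u * (shiftMatrix f w).transpose * (basisMatrix v).transpose := by
  ext i j
  rw [ketMatrix_sum_apply]
  simp only [Matrix.mul_apply, basisMatrix, shiftMatrix, Matrix.transpose_apply, Matrix.of_apply,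
    mul_ite, mul_zero, Finset.sum_mul, ite_mul, zero_mul]
  rw [Finset.sum_comm]
  refine Finset.sum_congr rfl fun g _ => ?_
  simp
  ring

/-- The coordinate matrix of a state whose Schmidt decomposition is shifted on the first side. -/
theorem ketMatrix_sum_shift_left {G : Type*} [Group G] [Fintype G] [DecidableEq G] (w : G → ℂ)
    (u v : OrthonormalBasis G ℂ (EuclideanSpace ℂ (Fin D))) (f : G) :
    ketMatrix (∑ g, w g • prodKet (u (f * g)) (v g)) =
      basisMatrix u * shiftMatrix f w * (basisMatrix v).transpose := by
  ext i j
  rw [ketMatrix_sum_apply]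
  simp only [Matrix.mul_apply, basisMatrix, shiftMatrix, Matrix.transpose_apply, Matrix.of_apply,
    mul_ite, mul_zero, Finset.sum_ite_eq', Finset.mem_univ, if_true]
  refine Finset.sum_congr rfl fun g _ => ?_
  ring

/-- In coordinates, the maximally entangled states are the unitary matrices divided by `√D`. -/
theorem isMaximallyEntangled_iff [NeZero D] (χ : Ket D) :
    IsMaximallyEntangled χ ↔
      ∃ W, IsUnitary W ∧ ketMatrix χ = ((Real.sqrt D)⁻¹ : ℂ) • W := by
  have hsqrt : (Real.sqrt (1 / (D : ℝ)) : ℂ) = ((Real.sqrt D)⁻¹ : ℂ) := by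
    rw [one_div, Real.sqrt_inv, Complex.ofReal_inv]
  constructor
  · rintro ⟨-, u, v, h⟩
    refine ⟨basisMatrix u * (basisMatrix v).transpose,
      (isUnitary_basisMatrix u).mul (isUnitary_basisMatrix v).transpose, ?_⟩
    ext i j
    rw [h, ketMatrix_sum_apply]
    simp only [hsqrt, ← Finset.mul_sum]
    simp [Matrix.mul_apply, basisMatrix]
  · rintro ⟨W, hW, h⟩
    obtain ⟨u, hu⟩ := exists_orthonormalBasis_of_isUnitary hW
    obtain ⟨v, hv⟩ := exists_orthonormalBasis_of_isUnitary
      (IsUnitary.one : IsUnitary (1 : Matrix (Fin D) (Fin D) ℂ))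
    refine ⟨fun _ => by positivity, u, v, ketMatrix_injective ?_⟩
    rw [h]
    ext i j
    rw [ketMatrix_sum_apply]
    simp only [hsqrt, ← Finset.mul_sum]
    simp [hu, hv, Matrix.one_apply]

theorem mulVec_joint (A B : Matrix (Fin D × Fin D) (Fin D × Fin D) ℂ) (ψ χ : Ket D) :
    (A ⊗ₖ B).mulVec (joint ψ χ) =
      fun x => (A * (ketMatrix ψ ⊗ₖ ketMatrix χ) * B.transpose) x.1 x.2 := by
  funext x
  have : ∀ y, joint ψ χ y = (ketMatrix ψ ⊗ₖ ketMatrix χ) y.1 y.2 := fun y => rfl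
  simp only [Matrix.mulVec, dotProduct, this]
  rw [Fintype.sum_prod_type, Finset.sum_comm, Matrix.mul_apply (N := B.transpose)]
  refine Finset.sum_congr rfl fun y _ => ?_
  rw [Matrix.mul_apply (M := A), Finset.sum_mul]
  refine Finset.sum_congr rfl fun z _ => ?_
  rw [Matrix.kroneckerMap_apply, Matrix.transpose_apply]
  ring

theorem mul_ketbra_mul_conjTranspose {α β : Type} [Fintype α] (K : Matrix β α ℂ) (v : α → ℂ) :
    K * ketbra v * K.conjTranspose = ketbra (K.mulVec v) := by
  rw [ketbra, Matrix.mul_vecMulVec, Matrix.vecMulVec_mul, ketbra, Matrix.star_mulVec]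

theorem ketbra_smul {α : Type} (c : ℂ) (v : α → ℂ) :
    ketbra (c • v) = ((‖c‖ ^ 2 : ℝ) : ℂ) • ketbra v := by
  ext i j
  simp only [ketbra, Matrix.vecMulVec_apply, Pi.smul_apply, Pi.star_apply, Matrix.smul_apply,
    smul_eq_mul, star_mul', Complex.ofReal_pow, ← Complex.mul_conj', Complex.star_def]
  ring

/-- If projectors onto finitely many vectors add up to the projector onto a unit vector `w`, the
vectors are multiples of `w`. -/
theorem exists_smul_of_sum_ketbra_eq {α : Type} [Fintype α] {M : ℕ} (x : Fin M → α → ℂ)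
    {w : α → ℂ} (hw : star w ⬝ᵥ w = 1) (h : ∑ m, ketbra (x m) = ketbra w) :
    ∃ c : Fin M → ℂ, (∀ m, x m = c m • w) ∧ ∑ m, ‖c m‖ ^ 2 = 1 := by
  -- The quadratic form of both sides at an arbitrary vector.
  have hform : ∀ y : α → ℂ, ∑ m, ‖star y ⬝ᵥ x m‖ ^ 2 = ‖star y ⬝ᵥ w‖ ^ 2 := by
    intro y
    have hq : ∀ z : α → ℂ, star y ⬝ᵥ (ketbra z).mulVec y = ((‖star y ⬝ᵥ z‖ ^ 2 : ℝ) : ℂ) := by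
      intro z
      rw [ketbra, Matrix.vecMulVec_mulVec, dotProduct_smul, Complex.ofReal_pow,
        ← Complex.mul_conj', ← Complex.star_def, ← Matrix.star_dotProduct_star, star_star]
      simp [dotProduct_comm]
    have h2 := congrArg (fun X => star y ⬝ᵥ Matrix.mulVec X y) h
    simp only [Matrix.sum_mulVec, dotProduct_sum, hq] at h2
    exact_mod_cast h2
  refine ⟨fun m => star w ⬝ᵥ x m, fun m => ?_, ?_⟩
  · set y : α → ℂ := x m - (star w ⬝ᵥ x m) • w with hy
    have hyw : star w ⬝ᵥ y = 0 := by
      rw [hy, dotProduct_sub, dotProduct_smul, hw, smul_eq_mul, mul_one, sub_self]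
    have hyw' : star y ⬝ᵥ w = 0 := by
      rw [Matrix.star_dotProduct, hyw, star_zero]
    have h3 := hform y
    rw [hyw', norm_zero, zero_pow two_ne_zero] at h3
    have h4 := (Finset.sum_eq_zero_iff_of_nonneg fun m _ => by positivity).1 h3 m
      (Finset.mem_univ m)
    have h5 : star y ⬝ᵥ x m = 0 := by simpa using h4
    have h6 : star y ⬝ᵥ y = 0 := by
      conv_lhs => rw [hy, dotProduct_sub, dotProduct_smul, ← hy]
      rw [h5, hyw']
      simp
    have h7 : y = 0 := by
      funext i
      have h8 : ∑ i, ‖y i‖ ^ 2 = 0 := by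
        have : ((∑ i, ‖y i‖ ^ 2 : ℝ) : ℂ) = star y ⬝ᵥ y := by
          push_cast
          refine Finset.sum_congr rfl fun i _ => ?_
          rw [Pi.star_apply, Complex.star_def, Complex.conj_mul']
        rw [h6] at this
        exact_mod_cast this
      have := (Finset.sum_eq_zero_iff_of_nonneg fun i _ => by positivity).1 h8 i
        (Finset.mem_univ i)
      simpa using this
    rw [hy, sub_eq_zero] at h7
    exact h7
  · rw [hform w, hw, norm_one, one_pow]

/-- Only the matrix data of a separable cloning operation are needed for the necessary
conditions. -/
theorem SeparablyClonable.matrixClonable {ι : Type} {ψ : ι → Ket D} {φ : Ket D}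
    (hψ : ∀ i, ‖ψ i‖ = 1) (h : SeparablyClonable ψ φ) :
    MatrixClonable (fun i => ketMatrix (ψ i)) (ketMatrix φ) := by
  obtain ⟨L, ⟨M, A, B, hcl, hL⟩, hclone⟩ := h
  have hnorm : ∀ i, star (joint (ψ i) (ψ i)) ⬝ᵥ joint (ψ i) (ψ i) = 1 := by
    intro i
    have h1 : star (joint (ψ i) (ψ i)) ⬝ᵥ joint (ψ i) (ψ i) =
        ((∑ p, ‖ψ i p‖ ^ 2) * ∑ q, ‖ψ i q‖ ^ 2 : ℝ) := by
      rw [Finset.sum_mul_sum]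
      push_cast
      simp only [dotProduct, Fintype.sum_prod_type, joint, Pi.star_apply, Complex.star_def,
        Complex.conj_mul', norm_mul]
      push_cast
      refine Finset.sum_congr rfl fun a _ => ?_
      rw [Finset.sum_comm]
      refine Finset.sum_congr rfl fun b _ => Finset.sum_congr rfl fun c _ =>
        Finset.sum_congr rfl fun d _ => ?_
      ring
    rw [h1, ← EuclideanSpace.norm_sq_eq, hψ]
    simp
  have hx : ∀ i, ∃ c : Fin M → ℂ,
      (∀ m, (A m ⊗ₖ B m).mulVec (joint (ψ i) φ) = c m • joint (ψ i) (ψ i)) ∧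
        ∑ m, ‖c m‖ ^ 2 = 1 := by
    intro i
    refine exists_smul_of_sum_ketbra_eq _ (hnorm i) ?_
    rw [← hclone i, hL]
    exact Finset.sum_congr rfl fun m _ => (mul_ketbra_mul_conjTranspose _ _).symm
  choose c hc hc1 using hx
  refine ⟨M, A, B, c, ?_, fun i m => ?_, hc1⟩
  · have := congrArg Matrix.trace hcl
    rw [Matrix.trace_sum, Matrix.trace_kronecker, Matrix.trace_one] at this
    simp only [Matrix.trace_kronecker, trace_conjTranspose_mul_self_eq_frobSq] at this
    have h2 : ∑ m, frobSq (A m) * frobSq (B m) =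
        (Fintype.card (Fin D × Fin D) : ℝ) * Fintype.card (Fin D × Fin D) := by
      exact_mod_cast this
    rw [h2, Fintype.card_prod]
    push_cast
    ring
  · ext p q
    have := congrFun (hc i m) (p, q)
    rw [mulVec_joint] at this
    exact this

end Coordinates

/-! ### Operations by LOCC are separable -/

/-- The Kraus operators of an LOCC operation are product operators, one for each branch of the
protocol. -/
theorem IsLOCC.exists_product_kraus {α' β' : Type} [Fintype α'] [DecidableEq α'] [Fintype β']
    [DecidableEq β'] {α β : Type} [Fintype α] [DecidableEq α] [Fintype β] [DecidableEq β]
    {L : Matrix (α × β) (α × β) ℂ → Matrix (α' × β') (α' × β') ℂ} (h : IsLOCC α β L) :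
    ∃ (κ : Type) (_ : Fintype κ) (A : κ → Matrix α' α ℂ) (B : κ → Matrix β' β ℂ),
      (∑ m, ((A m).conjTranspose * A m) ⊗ₖ ((B m).conjTranspose * B m)
        = (1 : Matrix α α ℂ) ⊗ₖ (1 : Matrix β β ℂ)) ∧
      ∀ ρ, L ρ = ∑ m, (A m ⊗ₖ B m) * ρ * (A m ⊗ₖ B m).conjTranspose := by
  induction h with
  | done => exact ⟨Unit, inferInstance, fun _ => 1, fun _ => 1, by simp, by simp⟩
  | @alice α β _ _ _ _ n γ _ _ K hK L _ ih =>
    choose κ hκ A B hcl hL using ih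
    refine ⟨Σ r, κ r, inferInstance, fun x => A x.1 x.2 * K x.1, fun x => B x.1 x.2, ?_,
      fun ρ => ?_⟩
    · rw [Fintype.sum_sigma, ← hK]
      have hr : ∀ r, ∑ m, ((A r m * K r).conjTranspose * (A r m * K r)) ⊗ₖ
          ((B r m).conjTranspose * B r m) =
          ((K r).conjTranspose * K r) ⊗ₖ (1 : Matrix β β ℂ) := by
        intro r
        calc _ = ((K r).conjTranspose ⊗ₖ (1 : Matrix β β ℂ)) *
              (∑ m, ((A r m).conjTranspose * A r m) ⊗ₖ ((B r m).conjTranspose * B r m)) *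
              (K r ⊗ₖ (1 : Matrix β β ℂ)) := by
              rw [Matrix.mul_sum, Matrix.sum_mul]
              refine Finset.sum_congr rfl fun m _ => ?_
              rw [← Matrix.mul_kronecker_mul, ← Matrix.mul_kronecker_mul, Matrix.one_mul,
                Matrix.mul_one, Matrix.conjTranspose_mul]
              simp only [Matrix.mul_assoc]
          _ = _ := by
              rw [hcl, ← Matrix.mul_kronecker_mul, ← Matrix.mul_kronecker_mul, Matrix.mul_one,
                Matrix.one_mul, Matrix.one_mul]
      simp only [hr]
      ext p q
      simp only [Matrix.sum_apply, Matrix.kroneckerMap_apply, Finset.sum_mul]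
    · rw [Fintype.sum_sigma]
      refine Finset.sum_congr rfl fun r _ => ?_
      rw [hL]
      refine Finset.sum_congr rfl fun m _ => ?_
      have : (A r m * K r) ⊗ₖ B r m = (A r m ⊗ₖ B r m) * (K r ⊗ₖ (1 : Matrix β β ℂ)) := by
        rw [← Matrix.mul_kronecker_mul, Matrix.mul_one]
      rw [this, Matrix.conjTranspose_mul]
      simp only [Matrix.mul_assoc]
  | @bob α β _ _ _ _ n γ _ _ K hK L _ ih =>
    choose κ hκ A B hcl hL using ih
    refine ⟨Σ r, κ r, inferInstance, fun x => A x.1 x.2, fun x => B x.1 x.2 * K x.1, ?_,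
      fun ρ => ?_⟩
    · rw [Fintype.sum_sigma, ← hK]
      have hr : ∀ r, ∑ m, ((A r m).conjTranspose * A r m) ⊗ₖ
          ((B r m * K r).conjTranspose * (B r m * K r)) =
          (1 : Matrix α α ℂ) ⊗ₖ ((K r).conjTranspose * K r) := by
        intro r
        calc _ = ((1 : Matrix α α ℂ) ⊗ₖ (K r).conjTranspose) *
              (∑ m, ((A r m).conjTranspose * A r m) ⊗ₖ ((B r m).conjTranspose * B r m)) *
              ((1 : Matrix α α ℂ) ⊗ₖ K r) := by
              rw [Matrix.mul_sum, Matrix.sum_mul]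
              refine Finset.sum_congr rfl fun m _ => ?_
              rw [← Matrix.mul_kronecker_mul, ← Matrix.mul_kronecker_mul, Matrix.one_mul,
                Matrix.mul_one, Matrix.conjTranspose_mul]
              simp only [Matrix.mul_assoc]
          _ = _ := by
              rw [hcl, ← Matrix.mul_kronecker_mul, ← Matrix.mul_kronecker_mul, Matrix.mul_one,
                Matrix.one_mul, Matrix.mul_one]
      simp only [hr]
      ext p q
      simp only [Matrix.sum_apply, Matrix.kroneckerMap_apply, Finset.mul_sum]
    · rw [Fintype.sum_sigma]
      refine Finset.sum_congr rfl fun r _ => ?_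
      rw [hL]
      refine Finset.sum_congr rfl fun m _ => ?_
      have : A r m ⊗ₖ (B r m * K r) = (A r m ⊗ₖ B r m) * ((1 : Matrix α α ℂ) ⊗ₖ K r) := by
        rw [← Matrix.mul_kronecker_mul, Matrix.mul_one]
      rw [this, Matrix.conjTranspose_mul]
      simp only [Matrix.mul_assoc]

theorem LOCCClonable.separablyClonable {D : ℕ} {ι : Type} {ψ : ι → Ket D} {φ : Ket D}
    (h : LOCCClonable ψ φ) : SeparablyClonable ψ φ := by
  obtain ⟨L, hL, hclone⟩ := h
  obtain ⟨κ, _, A, B, hcl, hk⟩ := hL.exists_product_kraus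
  let e := (Fintype.equivFin κ).symm
  refine ⟨L, ⟨Fintype.card κ, fun m => A (e m), fun m => B (e m), ?_, fun ρ => ?_⟩, hclone⟩
  · rw [← hcl]
    exact Equiv.sum_comp e fun m =>
      ((A m).conjTranspose * A m) ⊗ₖ ((B m).conjTranspose * B m)
  · rw [hk]
    exact (Equiv.sum_comp e fun m => (A m ⊗ₖ B m) * ρ * (A m ⊗ₖ B m).conjTranspose).symm

/-! ### Cloning shifted states with a maximally entangled blank -/

section Protocol

/-- A measurement by the first party, followed by a unitary of the second party that depends on
the outcome. -/
theorem isLOCC_alice_bob {α β : Type} [Fintype α] [DecidableEq α] [Fintype β] [DecidableEq β]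
    {κ : Type} [Fintype κ] (K : κ → Matrix α α ℂ) (R : κ → Matrix β β ℂ)
    (hK : ∑ r, (K r).conjTranspose * K r = 1) (hR : ∀ r, (R r).conjTranspose * R r = 1) :
    IsLOCC (α' := α) (β' := β) α β
      (fun ρ => ∑ r, (K r ⊗ₖ R r) * ρ * (K r ⊗ₖ R r).conjTranspose) := by
  let e := (Fintype.equivFin κ).symm
  have h := IsLOCC.alice (α := α) (β := β) (fun r => K (e r))
    (by rw [← hK]; exact Equiv.sum_comp e fun r => (K r).conjTranspose * K r)
    (fun r ρ => ∑ _ : Fin 1, ((1 : Matrix α α ℂ) ⊗ₖ R (e r)) * ρ *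
      ((1 : Matrix α α ℂ) ⊗ₖ R (e r)).conjTranspose)
    (fun r => IsLOCC.bob (fun _ : Fin 1 => R (e r)) (by simp [hR]) (fun _ ρ => ρ)
      fun _ => IsLOCC.done)
  convert h using 2 with ρ
  rw [← Equiv.sum_comp e]
  refine Finset.sum_congr rfl fun r _ => ?_
  have : K (e r) ⊗ₖ R (e r) =
      ((1 : Matrix α α ℂ) ⊗ₖ R (e r)) * (K (e r) ⊗ₖ (1 : Matrix β β ℂ)) := by
    rw [← Matrix.mul_kronecker_mul, Matrix.one_mul, Matrix.mul_one]
  rw [this, Matrix.conjTranspose_mul]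
  simp [Matrix.mul_assoc]

/-- A measurement by the second party, followed by a unitary of the first party that depends on
the outcome. -/
theorem isLOCC_bob_alice {α β : Type} [Fintype α] [DecidableEq α] [Fintype β] [DecidableEq β]
    {κ : Type} [Fintype κ] (R : κ → Matrix α α ℂ) (K : κ → Matrix β β ℂ)
    (hK : ∑ r, (K r).conjTranspose * K r = 1) (hR : ∀ r, (R r).conjTranspose * R r = 1) :
    IsLOCC (α' := α) (β' := β) α β
      (fun ρ => ∑ r, (R r ⊗ₖ K r) * ρ * (R r ⊗ₖ K r).conjTranspose) := by
  let e := (Fintype.equivFin κ).symm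
  have h := IsLOCC.bob (α := α) (β := β) (fun r => K (e r))
    (by rw [← hK]; exact Equiv.sum_comp e fun r => (K r).conjTranspose * K r)
    (fun r ρ => ∑ _ : Fin 1, (R (e r) ⊗ₖ (1 : Matrix β β ℂ)) * ρ *
      (R (e r) ⊗ₖ (1 : Matrix β β ℂ)).conjTranspose)
    (fun r => IsLOCC.alice (fun _ : Fin 1 => R (e r)) (by simp [hR]) (fun _ ρ => ρ)
      fun _ => IsLOCC.done)
  convert h using 2 with ρ
  rw [← Equiv.sum_comp e]
  refine Finset.sum_congr rfl fun r _ => ?_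
  have : R (e r) ⊗ₖ K (e r) =
      (R (e r) ⊗ₖ (1 : Matrix β β ℂ)) * ((1 : Matrix α α ℂ) ⊗ₖ K (e r)) := by
    rw [← Matrix.mul_kronecker_mul, Matrix.one_mul, Matrix.mul_one]
  rw [this, Matrix.conjTranspose_mul]
  simp [Matrix.mul_assoc]

/-- Kraus operators that act on each state as a multiple of the cloning map give a cloning
operation, if the squared moduli of the factors add up to one. -/
theorem clones_of_matrix_eq {D : ℕ} {ι : Type} {κ : Type} [Fintype κ] {ψ : ι → Ket D} {φ : Ket D}
    {A B : κ → Matrix (Fin D × Fin D) (Fin D × Fin D) ℂ} {z : ℂ}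
    (hz : (Fintype.card κ : ℝ) * ‖z‖ ^ 2 = 1)
    (h : ∀ i r, A r * (ketMatrix (ψ i) ⊗ₖ ketMatrix φ) * (B r).transpose =
      z • (ketMatrix (ψ i) ⊗ₖ ketMatrix (ψ i))) :
    Clones (fun ρ => ∑ r, (A r ⊗ₖ B r) * ρ * (A r ⊗ₖ B r).conjTranspose) ψ φ := by
  intro i
  have h1 : ∀ r, (A r ⊗ₖ B r).mulVec (joint (ψ i) φ) = z • joint (ψ i) (ψ i) := by
    intro r
    rw [mulVec_joint, h]
    rfl
  simp only [mul_ketbra_mul_conjTranspose, h1, ketbra_smul, Finset.sum_const, Finset.card_univ]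
  rw [← Nat.cast_smul_eq_nsmul ℂ, smul_smul]
  have : ((Fintype.card κ : ℕ) : ℂ) * ((‖z‖ ^ 2 : ℝ) : ℂ) = 1 := by exact_mod_cast hz
  rw [this, one_smul]

variable {G : Type} [Group G] [Fintype G] [DecidableEq G]

/-- The controlled shift `|g⟩|h⟩ ↦ d (g * h * r) |g⟩|g * h * r⟩`: a unitary if `d = 1`.
If the squared moduli of `d` add up to one, these operators, for `r` in the group, are the Kraus
operators of a measurement. -/
def controlledShift (d : G → ℂ) (r : G) : Matrix (G × G) (G × G) ℂ :=
  Matrix.of fun p q => if p = (q.1, q.1 * q.2 * r) then d p.2 else 0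

theorem controlledShift_conjTranspose_mul_self (d : G → ℂ) (r : G) :
    (controlledShift d r).conjTranspose * controlledShift d r =
      Matrix.diagonal fun q => ((‖d (q.1 * q.2 * r)‖ ^ 2 : ℝ) : ℂ) := by
  ext q q'
  by_cases hq : q = q'
  · subst hq
    rw [Matrix.mul_apply, Finset.sum_eq_single (q.1, q.1 * q.2 * r)]
    · simp [controlledShift, Complex.conj_mul']
    · intro p _ hp
      simp [controlledShift, hp]
    · simp
  · rw [Matrix.diagonal_apply_ne _ hq, Matrix.mul_apply]
    refine Finset.sum_eq_zero fun p _ => ?_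
    by_cases h1 : p = (q.1, q.1 * q.2 * r)
    · have h2 : p ≠ (q'.1, q'.1 * q'.2 * r) := by
        intro h2
        apply hq
        rw [h1, Prod.mk.injEq] at h2
        obtain ⟨h3, h4⟩ := h2
        rw [h3] at h4
        exact Prod.ext h3 (mul_left_cancel (mul_right_cancel h4))
      simp [controlledShift, h2]
    · simp [controlledShift, h1]

theorem controlledShift_mul_shift (d : G → ℂ) (r f : G) :
    controlledShift d r * ((shiftMatrix f d).transpose ⊗ₖ (1 : Matrix G G ℂ)) *
      (controlledShift 1 r).transpose =
    (shiftMatrix f d).transpose ⊗ₖ (shiftMatrix f d).transpose := by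
  have h1 : ∀ g y q, (controlledShift d r * ((shiftMatrix f d).transpose ⊗ₖ (1 : Matrix G G ℂ)))
      (g, y) q = if q = (f * g, g⁻¹ * y * r⁻¹) then d y * d g else 0 := by
    rintro g y ⟨x, h⟩
    rw [Matrix.mul_apply, Finset.sum_eq_single (g, g⁻¹ * y * r⁻¹)]
    · rcases eq_or_ne h (g⁻¹ * y * r⁻¹) with rfl | hh
      · by_cases hx : x = f * g <;> simp [controlledShift, shiftMatrix, hx, mul_assoc]
      · simp [hh, hh.symm]
    · rintro ⟨g', h'⟩ - hne
      have : (g, y) ≠ (g', g' * h' * r) := by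
        intro h2
        rw [Prod.mk.injEq] at h2
        apply hne
        rw [h2.1, h2.2]
        simp [mul_assoc]
      simp [controlledShift, this]
    · simp
  ext ⟨g, y⟩ ⟨x, z⟩
  rw [Matrix.mul_apply]
  simp only [h1, ite_mul, zero_mul, Finset.sum_ite_eq', Finset.mem_univ, if_true]
  have : (x, z) = (f * g, f * g * (g⁻¹ * y * r⁻¹) * r) ↔ x = f * g ∧ z = f * y := by
    rw [Prod.mk.injEq]
    simp [mul_assoc]
  simp only [controlledShift, shiftMatrix, Matrix.transpose_apply, Matrix.of_apply, this,
    Matrix.kroneckerMap_apply]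
  by_cases hx : x = f * g <;> by_cases hz : z = f * y <;> simp [hx, hz, mul_comm]

/-- The cloning protocol.  In the bases `U`, `V` of the Schmidt decomposition both parties apply a
controlled shift; the first one also measures its half of the blank with weights given by the
Schmidt coefficients, and the outcome `r` tells both how to shift back. -/
theorem exists_cloning_kraus {m : Type} [Fintype m] [DecidableEq m] {U V : Matrix m G ℂ}
    {W : Matrix m m ℂ} (hU : IsUnitary U) (hV : IsUnitary V) (hW : IsUnitary W) {d : G → ℂ}
    (hd : ∑ g, ‖d g‖ ^ 2 = 1) :
    ∃ K R : G → Matrix (m × m) (m × m) ℂ, ∑ r, (K r).conjTranspose * K r = 1 ∧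
      (∀ r, (R r).conjTranspose * R r = 1) ∧
      ∀ f r, K r * ((U * (shiftMatrix f d).transpose * V.transpose) ⊗ₖ W) * (R r).transpose =
        (U * (shiftMatrix f d).transpose * V.transpose) ⊗ₖ
          (U * (shiftMatrix f d).transpose * V.transpose) := by
  have hconj : ∀ {P Q : Matrix (m × m) (G × G) ℂ} {S : Matrix (G × G) (G × G) ℂ},
      IsUnitary P → (P * S * Q.conjTranspose).conjTranspose * (P * S * Q.conjTranspose) =
        Q * (S.conjTranspose * S) * Q.conjTranspose := by
    intro P Q S hP
    calc _ = Q * (S.conjTranspose * (P.conjTranspose * P) * S) * Q.conjTranspose := by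
          simp only [Matrix.conjTranspose_mul, Matrix.conjTranspose_conjTranspose,
            Matrix.mul_assoc]
      _ = _ := by rw [hP.1, Matrix.mul_one]
  have hUU := hU.kronecker hU
  have hVV := hV.kronecker hV
  -- The blank is `W = (W U) Uᴴ`, so it looks like the identity in the bases `W U` and `conj U`.
  have hUWU := hU.kronecker (hW.mul hU)
  have hVU := hV.kronecker hU.conjTranspose.transpose
  refine ⟨fun r => (U ⊗ₖ U) * controlledShift d r * (U ⊗ₖ (W * U)).conjTranspose,
    fun r => (V ⊗ₖ V) * controlledShift 1 r * (V ⊗ₖ U.conjTranspose.transpose).conjTranspose,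
    ?_, fun r => ?_, fun f r => ?_⟩
  · simp only [hconj hUU, controlledShift_conjTranspose_mul_self]
    rw [← Matrix.sum_mul, ← Matrix.mul_sum]
    have : ∑ r, Matrix.diagonal (fun q : G × G => ((‖d (q.1 * q.2 * r)‖ ^ 2 : ℝ) : ℂ)) = 1 := by
      ext q q'
      rw [Matrix.sum_apply]
      by_cases hq : q = q'
      · subst hq
        simp only [Matrix.diagonal_apply_eq, Matrix.one_apply_eq]
        rw [← Complex.ofReal_sum, ← Complex.ofReal_one, ← hd]
        congr 1
        exact Equiv.sum_comp (Equiv.mulLeft (q.1 * q.2)) fun x => ‖d x‖ ^ 2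
      · simp [Matrix.diagonal_apply_ne _ hq, Matrix.one_apply_ne hq]
    rw [this, Matrix.mul_one, hUWU.2]
  · rw [hconj hVV, controlledShift_conjTranspose_mul_self]
    simp only [Pi.one_apply, norm_one, one_pow, Complex.ofReal_one, Matrix.diagonal_one]
    rw [Matrix.mul_one, hVU.2]
  · have hU' : U.conjTranspose.transpose.conjTranspose.transpose = U := by
      ext i j
      simp
    have hV' : V.transpose * V.conjTranspose.transpose = 1 := by
      rw [← Matrix.transpose_mul, hV.1, Matrix.transpose_one]
    have hmid : (U ⊗ₖ (W * U)).conjTranspose *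
        ((U * (shiftMatrix f d).transpose * V.transpose) ⊗ₖ W) *
        (V ⊗ₖ U.conjTranspose.transpose).conjTranspose.transpose =
        (shiftMatrix f d).transpose ⊗ₖ (1 : Matrix G G ℂ) := by
      rw [Matrix.conjTranspose_kronecker, Matrix.conjTranspose_kronecker,
        ← Matrix.kroneckerMap_transpose, hU', ← Matrix.mul_kronecker_mul,
        ← Matrix.mul_kronecker_mul]
      congr 1
      · simp only [Matrix.mul_assoc]
        rw [hV', Matrix.mul_one, ← Matrix.mul_assoc, hU.1, Matrix.one_mul]
      · rw [Matrix.mul_assoc, (hW.mul hU).1]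
    calc _ = (U ⊗ₖ U) * (controlledShift d r * ((U ⊗ₖ (W * U)).conjTranspose *
          ((U * (shiftMatrix f d).transpose * V.transpose) ⊗ₖ W) *
          (V ⊗ₖ U.conjTranspose.transpose).conjTranspose.transpose) *
          (controlledShift 1 r).transpose) * (V ⊗ₖ V).transpose := by
          simp only [Matrix.transpose_mul, Matrix.mul_assoc]
      _ = _ := by
          rw [hmid, controlledShift_mul_shift, ← Matrix.kroneckerMap_transpose,
            ← Matrix.mul_kronecker_mul, ← Matrix.mul_kronecker_mul]

variable {D : ℕ} {u v : OrthonormalBasis G ℂ (EuclideanSpace ℂ (Fin D))} {d : G → ℂ}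
  {ψ : G → Ket D} {φ : Ket D}

theorem card_eq_of_orthonormalBasis {κ : Type*} [Fintype κ]
    (u : OrthonormalBasis κ ℂ (EuclideanSpace ℂ (Fin D))) : Fintype.card κ = D := by
  rw [← Module.finrank_eq_card_basis u.toBasis, finrank_euclideanSpace_fin]

theorem card_mul_norm_inv_sqrt_sq {G : Type} [Fintype G] [NeZero D] (hG : Fintype.card G = D) :
    (Fintype.card G : ℝ) * ‖((Real.sqrt D)⁻¹ : ℂ)‖ ^ 2 = 1 := by
  have hD : (0 : ℝ) < D := by exact_mod_cast Nat.pos_of_ne_zero (NeZero.ne D)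
  rw [hG, norm_inv, Complex.norm_real, Real.norm_eq_abs, inv_pow, sq_abs, Real.sq_sqrt hD.le,
    mul_inv_cancel₀ hD.ne']

theorem locc_clonable_of_shift_right [NeZero D] (hd : ∑ g, ‖d g‖ ^ 2 = 1)
    (hψ : ∀ f, ψ f = ∑ g, d g • prodKet (u g) (v (f * g))) (hφ : IsMaximallyEntangled φ) :
    LOCCClonable ψ φ := by
  obtain ⟨W, hW, hφW⟩ := (isMaximallyEntangled_iff φ).1 hφ
  obtain ⟨K, R, hK, hR, h⟩ :=
    exists_cloning_kraus (isUnitary_basisMatrix u) (isUnitary_basisMatrix v) hW hd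
  refine ⟨_, isLOCC_alice_bob K R hK hR,
    clones_of_matrix_eq (card_mul_norm_inv_sqrt_sq (card_eq_of_orthonormalBasis u))
      fun f r => ?_⟩
  rw [hψ, ketMatrix_sum_shift, hφW, Matrix.kronecker_smul, Matrix.mul_smul, Matrix.smul_mul, h]

theorem locc_clonable_of_shift_left [NeZero D] (hd : ∑ g, ‖d g‖ ^ 2 = 1)
    (hψ : ∀ f, ψ f = ∑ g, d g • prodKet (u (f * g)) (v g)) (hφ : IsMaximallyEntangled φ) :
    LOCCClonable ψ φ := by
  obtain ⟨W, hW, hφW⟩ := (isMaximallyEntangled_iff φ).1 hφ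
  obtain ⟨K, R, hK, hR, h⟩ :=
    exists_cloning_kraus (isUnitary_basisMatrix v) (isUnitary_basisMatrix u) hW.transpose hd
  refine ⟨_, isLOCC_bob_alice R K hK hR,
    clones_of_matrix_eq (card_mul_norm_inv_sqrt_sq (card_eq_of_orthonormalBasis u))
      fun f r => ?_⟩
  rw [hψ, ketMatrix_sum_shift_left, hφW, Matrix.kronecker_smul, Matrix.mul_smul, Matrix.smul_mul]
  congr 1
  have := congrArg Matrix.transpose (h f r)
  simpa only [Matrix.transpose_mul, Matrix.transpose_transpose, ← Matrix.kroneckerMap_transpose,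
    Matrix.mul_assoc] using this

end Protocol

/-! ### Necessity for group-shifted states -/

/-- A normalized blank that clones group-shifted states, for a group with at most three elements,
is maximally entangled. -/
theorem MatrixClonable.isMaximallyEntangled {D : ℕ} [NeZero D] {G : Type} [Group G] [Fintype G]
    [DecidableEq G] (hG : Fintype.card G ≤ 3) {l : G → ℝ} (hl : ∀ g, 0 < l g)
    (hsum : ∑ g, l g = 1) {w : G → G → ℂ} (hw : ∀ f g, ‖w f g‖ ^ 2 = l g)
    {ψ : G → Ket D} {φ : Ket D} (hφ : ‖φ‖ = 1)
    (u v : OrthonormalBasis G ℂ (EuclideanSpace ℂ (Fin D)))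
    (hψ : (∀ f, ψ f = ∑ g, w f g • prodKet (u g) (v (f * g))) ∨
      (∀ f, ψ f = ∑ g, w f g • prodKet (u (f * g)) (v g)))
    (h : MatrixClonable (fun f => ketMatrix (ψ f)) (ketMatrix φ)) : IsMaximallyEntangled φ := by
  have hcard : Fintype.card (Fin D) = Fintype.card G := by
    rw [card_eq_of_orthonormalBasis u, Fintype.card_fin]
  have hu := isUnitary_basisMatrix u
  have hv := isUnitary_basisMatrix v
  -- Any coordinates indexed by `G` serve to compare the blank with a matrix over `G`.
  set Φ' := (basisMatrix u).conjTranspose * ketMatrix φ * (basisMatrix v).conjTranspose.transpose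
    with hΦ'
  have hvv : (basisMatrix v).conjTranspose.transpose * (basisMatrix v).transpose = 1 := by
    rw [← Matrix.transpose_mul, hv.2, Matrix.transpose_one]
  have hφ' : ketMatrix φ = basisMatrix u * Φ' * (basisMatrix v).transpose := by
    rw [hΦ']
    simp only [Matrix.mul_assoc]
    rw [hvv, Matrix.mul_one, ← Matrix.mul_assoc, hu.2, Matrix.one_mul]
  have hnorm : frobSq Φ' = 1 := by
    rw [hΦ', frobSq_mul_unitary hv.conjTranspose.transpose, frobSq_unitary_mul hu.conjTranspose,
      frobSq_ketMatrix, hφ, one_pow]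
  have hW : ∃ W, IsUnitary W ∧ Φ' = ((Real.sqrt (Fintype.card G))⁻¹ : ℂ) • W := by
    rcases hψ with hψ | hψ
    · have h1 : MatrixClonable (fun f => (shiftMatrix f (w f)).transpose) Φ' :=
        h.unitary_equiv hu hv hu hv hcard
          (fun f => by simp only [hψ, ketMatrix_sum_shift]) hφ'
      have h2 := h1.transpose
      simp only [Matrix.transpose_transpose] at h2
      obtain ⟨W, hW, hWΦ⟩ := h2.blank_unitary hG hl hsum hw (by rw [frobSq_transpose, hnorm])
      refine ⟨W.transpose, hW.transpose, ?_⟩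
      rw [← Matrix.transpose_smul, ← hWΦ, Matrix.transpose_transpose]
    · have h1 : MatrixClonable (fun f => shiftMatrix f (w f)) Φ' :=
        h.unitary_equiv hu hv hu hv hcard
          (fun f => by simp only [hψ, ketMatrix_sum_shift_left]) hφ'
      exact h1.blank_unitary hG hl hsum hw hnorm
  obtain ⟨W, hW, hWΦ⟩ := hW
  refine (isMaximallyEntangled_iff φ).2
    ⟨basisMatrix u * W * (basisMatrix v).transpose, (hu.mul hW).mul hv.transpose, ?_⟩
  rw [hφ', hWΦ, Matrix.mul_smul, Matrix.smul_mul, card_eq_of_orthonormalBasis u]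

theorem norm_eq_one_of_sum_shift {D : ℕ} {G : Type} [Group G] [Fintype G] [DecidableEq G]
    {l : G → ℝ} (hsum : ∑ g, l g = 1) {w : G → G → ℂ} (hw : ∀ f g, ‖w f g‖ ^ 2 = l g)
    {ψ : G → Ket D} (u v : OrthonormalBasis G ℂ (EuclideanSpace ℂ (Fin D)))
    (hψ : (∀ f, ψ f = ∑ g, w f g • prodKet (u g) (v (f * g))) ∨
      (∀ f, ψ f = ∑ g, w f g • prodKet (u (f * g)) (v g))) (f : G) : ‖ψ f‖ = 1 := by
  have hu := isUnitary_basisMatrix u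
  have hv := isUnitary_basisMatrix v
  have hS : frobSq (shiftMatrix f (w f)) = 1 := by
    have h1 : shiftMatrix f (w f) =
        shiftMatrix f (fun _ => 1) * Matrix.diagonal (w f) := by
      rw [shiftMatrix_mul_diagonal]
      simp
    rw [h1, frobSq_unitary_mul (isUnitary_shiftMatrix f fun _ => norm_one), frobSq_diagonal,
      ← hsum]
    exact Finset.sum_congr rfl fun g _ => hw f g
  refine (pow_eq_one_iff_of_nonneg (norm_nonneg _) two_ne_zero).1 ?_
  rw [← frobSq_ketMatrix]
  rcases hψ with hψ | hψ
  · rw [hψ, ketMatrix_sum_shift, frobSq_mul_unitary hv.transpose, frobSq_unitary_mul hu,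
      frobSq_transpose, hS]
  · rw [hψ, ketMatrix_sum_shift_left, frobSq_mul_unitary hv.transpose, frobSq_unitary_mul hu, hS]

/-! ### Pairs of entangled qubit states -/

section Qubits

/-- A two-qubit state is a product vector if the determinant of its coordinates vanishes. -/
theorem IsEntangled.det_ne_zero {ψ : Ket 2} (h : IsEntangled ψ) : (ketMatrix ψ).det ≠ 0 := by
  intro hdet
  rw [Matrix.det_fin_two] at hdet
  change ψ (0, 0) * ψ (1, 1) - ψ (0, 1) * ψ (1, 0) = 0 at hdet
  have build : ∀ x₀ x₁ y₀ y₁ : ℂ, ψ (0, 0) = x₀ * y₀ → ψ (0, 1) = x₀ * y₁ →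
      ψ (1, 0) = x₁ * y₀ → ψ (1, 1) = x₁ * y₁ → False := by
    intro x₀ x₁ y₀ y₁ h1 h2 h3 h4
    refine h ⟨!₂[x₀, x₁], !₂[y₀, y₁], ?_⟩
    ext ⟨i, j⟩
    fin_cases i <;> fin_cases j <;> simp [prodKet, h1, h2, h3, h4]
  by_cases ha : ψ (0, 0) = 0
  · rw [ha, zero_mul, zero_sub, neg_eq_zero] at hdet
    rcases mul_eq_zero.1 hdet with hb | hc
    · exact build 0 1 (ψ (1, 0)) (ψ (1, 1)) (by simp [ha]) (by simp [hb]) (by simp) (by simp)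
    · exact build (ψ (0, 1)) (ψ (1, 1)) 0 1 (by simp [ha]) (by simp) (by simp [hc]) (by simp)
  · refine build 1 (ψ (1, 0) / ψ (0, 0)) (ψ (0, 0)) (ψ (0, 1)) (by simp) (by simp) ?_ ?_
    · field_simp
    · field_simp
      linear_combination hdet

theorem trace_eq_of_intertwines {n : Type*} [Fintype n] [DecidableEq n] {A X Y : Matrix n n ℂ}
    (hA : IsUnit A) (h : A * X = Y * A) : X.trace = Y.trace := by
  obtain ⟨A, rfl⟩ := hA
  have : X = (↑A⁻¹ : Matrix n n ℂ) * (Y * A) := by rw [← h, ← mul_assoc, Units.inv_mul, one_mul]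
  rw [this, Matrix.trace_mul_comm, Matrix.mul_assoc, Units.mul_inv, Matrix.mul_one]

/-- If `T ⊗ 1` is similar to a multiple of `T ⊗ T` for an invertible `2 × 2` matrix `T`, then `T`
is scalar or traceless.  Otherwise the traces of `T` and `T²` show that a multiple of `T` is
unipotent, and comparing the nilpotent parts shows that this multiple is the identity. -/
theorem trace_eq_zero_of_intertwines {T : Matrix (Fin 2) (Fin 2) ℂ}
    {A : Matrix (Fin 2 × Fin 2) (Fin 2 × Fin 2) ℂ} {ω : ℂ} (hA : IsUnit A) (hT : T.det ≠ 0)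
    (h : A * (T ⊗ₖ (1 : Matrix (Fin 2) (Fin 2) ℂ)) = ω • ((T ⊗ₖ T) * A))
    (hscalar : ∀ z : ℂ, T ≠ z • 1) : T.trace = 0 := by
  by_contra ht
  have h1 : A * (T ⊗ₖ (1 : Matrix (Fin 2) (Fin 2) ℂ)) = (ω • (T ⊗ₖ T)) * A := by
    rw [h, Matrix.smul_mul]
  have hsq : A * ((T * T) ⊗ₖ (1 : Matrix (Fin 2) (Fin 2) ℂ)) =
      (ω ^ 2 • ((T * T) ⊗ₖ (T * T))) * A := by
    calc _ = A * (T ⊗ₖ (1 : Matrix (Fin 2) (Fin 2) ℂ)) *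
          (T ⊗ₖ (1 : Matrix (Fin 2) (Fin 2) ℂ)) := by
          rw [Matrix.mul_assoc, ← Matrix.mul_kronecker_mul, Matrix.one_mul]
      _ = _ := by
          rw [h1, Matrix.mul_assoc, h1, ← Matrix.mul_assoc, Matrix.mul_kronecker_mul,
            Matrix.smul_mul, Matrix.mul_smul, smul_smul, sq]
  have htr := trace_eq_of_intertwines hA h1
  have htr2 := trace_eq_of_intertwines hA hsq
  rw [Matrix.trace_kronecker, Matrix.trace_smul, Matrix.trace_kronecker, Matrix.trace_one,
    Fintype.card_fin, smul_eq_mul] at htr htr2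
  push_cast at htr htr2
  have hdet := congrArg Matrix.det h1
  rw [Matrix.det_mul, Matrix.det_mul, Matrix.det_smul, Matrix.det_kronecker,
    Matrix.det_kronecker, Matrix.det_one, Fintype.card_prod, Fintype.card_fin, mul_comm] at hdet
  have hdet2 := mul_right_cancel₀ ((Matrix.isUnit_iff_isUnit_det A).1 hA).ne_zero hdet
  -- The theorem of Cayley and Hamilton in dimension two.
  have hCH : T * T = T.trace • T - T.det • (1 : Matrix (Fin 2) (Fin 2) ℂ) := by
    ext i j
    fin_cases i <;> fin_cases j <;>
      simp [Matrix.mul_apply, Fin.sum_univ_two, Matrix.trace_fin_two, Matrix.det_fin_two] <;> ring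
  have hs : (T * T).trace = T.trace ^ 2 - 2 * T.det := by
    rw [hCH, Matrix.trace_sub, Matrix.trace_smul, Matrix.trace_smul, Matrix.trace_one,
      Fintype.card_fin]
    push_cast
    simp only [smul_eq_mul]
    ring
  have hω : ω * T.trace = 2 := by
    have : T.trace * (ω * T.trace) = T.trace * 2 := by linear_combination -htr
    exact mul_left_cancel₀ ht this
  have hΔ : (ω ^ 2 * T.det) ^ 2 = 1 := by
    have h2 : T.det ^ 2 * (ω ^ 2 * T.det) ^ 2 = T.det ^ 2 * 1 := by
      linear_combination -hdet2
    exact mul_left_cancel₀ (pow_ne_zero 2 hT) h2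
  have hσ : ω ^ 2 * (T * T).trace = 4 - 2 * (ω ^ 2 * T.det) := by
    rw [hs]
    linear_combination (ω * T.trace + 2) * hω
  have hσ2 : (ω ^ 2 * (T * T).trace) * (ω ^ 2 * (T * T).trace - 2) = 0 := by
    linear_combination -ω ^ 2 * htr2
  have hΔ1 : ω ^ 2 * T.det = 1 := by
    rw [hσ] at hσ2
    linear_combination -hσ2 / 12 + hΔ / 3
  let P := ω • T
  have hP : A * (P ⊗ₖ (1 : Matrix (Fin 2) (Fin 2) ℂ)) = (P ⊗ₖ P) * A := by
    simp only [P, Matrix.smul_kronecker, Matrix.kronecker_smul, Matrix.mul_smul, h1,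
      Matrix.smul_mul]
  have hPP : P * P = (2 : ℂ) • P - 1 := by
    simp only [P, Matrix.smul_mul, Matrix.mul_smul, hCH, smul_sub, smul_smul]
    have : ω * (ω * T.det) = 1 := by linear_combination hΔ1
    rw [this, one_smul]
    congr 2
    linear_combination ω * hω
  have hP2 : (P * P) ⊗ₖ (P * P) = (2 : ℂ) • (P ⊗ₖ P) - 1 := by
    refine hA.mul_right_cancel ?_
    calc (P * P) ⊗ₖ (P * P) * A = (P ⊗ₖ P) * ((P ⊗ₖ P) * A) := by
          rw [Matrix.mul_kronecker_mul, Matrix.mul_assoc]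
      _ = A * ((P * P) ⊗ₖ (1 : Matrix (Fin 2) (Fin 2) ℂ)) := by
          rw [← hP, ← Matrix.mul_assoc, ← hP, Matrix.mul_assoc, ← Matrix.mul_kronecker_mul,
            Matrix.one_mul]
      _ = ((2 : ℂ) • (P ⊗ₖ P) - 1) * A := by
          rw [hPP, Matrix.sub_mul, Matrix.one_mul, Matrix.smul_mul, ← hP, ← Matrix.mul_smul,
            ← Matrix.smul_kronecker]
          nth_rewrite 3 [← Matrix.mul_one A]
          rw [← Matrix.mul_sub]
          congr 1
          rw [← Matrix.one_kronecker_one]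
          ext p q
          simp only [Matrix.kroneckerMap_apply, Matrix.sub_apply]
          ring
  refine hscalar ω⁻¹ ?_
  have hω0 : ω ≠ 0 := by
    rintro rfl
    simp at hω
  have hN : P - 1 = 0 := by
    have hNN : (P - 1) ⊗ₖ (P - 1) = 0 := by
      have h3 : (2 : ℂ) • ((P - 1) ⊗ₖ (P - 1)) =
          (P * P) ⊗ₖ (P * P) - ((2 : ℂ) • (P ⊗ₖ P) - 1) := by
        rw [hPP, ← Matrix.one_kronecker_one]
        ext p q
        simp only [Matrix.smul_apply, Matrix.kroneckerMap_apply, Matrix.sub_apply, smul_eq_mul]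
        ring
      rw [hP2, sub_self] at h3
      exact (smul_eq_zero.1 h3).resolve_left two_ne_zero
    ext i j
    have := congrFun (congrFun hNN (i, i)) (j, j)
    simpa using this
  have h4 : ω • T = 1 := sub_eq_zero.1 hN
  rw [← h4, smul_smul, inv_mul_cancel₀ hω0, one_smul]

/-- A pair of `2 × 2` matrices of equal norms and determinants, orthogonal and related by a
traceless `T`, can be brought simultaneously to diagonal and antidiagonal form.  If the singular
values of the first one differ, its singular bases do it; otherwise the second one is a multiple
of a unitary matrix in these bases, and a further rotation makes its diagonal vanish. -/
theorem exists_bases_antidiagonal {Ψ₀ Ψ₁ T : Matrix (Fin 2) (Fin 2) ℂ} (hT : T * Ψ₀ = Ψ₁)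
    (htr : T.trace = 0) (hdet : Ψ₀.det ≠ 0) (hdet' : ‖Ψ₀.det‖ = ‖Ψ₁.det‖) (h₀ : frobSq Ψ₀ = 1)
    (h₁ : frobSq Ψ₁ = 1) (horth : (Ψ₀.conjTranspose * Ψ₁).trace = 0) :
    ∃ (U V : Matrix (Fin 2) (Fin 2) ℂ) (a b : ℝ) (x z : ℂ), IsUnitary U ∧ IsUnitary V ∧
      0 < a ∧ 0 < b ∧ Ψ₀ = U * !![(a : ℂ), 0; 0, (b : ℂ)] * V.transpose ∧
      Ψ₁ = U * !![0, x; z, 0] * V.transpose := by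
  obtain ⟨U, V, s, hU, hV, hs, hsvd⟩ := exists_svd Ψ₀ hdet
  have hdiag : (Matrix.diagonal fun i => (s i : ℂ)) = !![(s 0 : ℂ), 0; 0, (s 1 : ℂ)] := by
    ext i j
    fin_cases i <;> fin_cases j <;> simp
  rw [hdiag] at hsvd
  set S₀ : Matrix (Fin 2) (Fin 2) ℂ := !![(s 0 : ℂ), 0; 0, (s 1 : ℂ)] with hS₀
  set R := U.conjTranspose * T * U with hR
  have hΨ₁ : Ψ₁ = U * (R * S₀) * V.transpose := by
    rw [← hT, hsvd, hR]
    simp only [← Matrix.mul_assoc]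
    rw [hU.2, Matrix.one_mul]
  have hRtr : R 0 0 + R 1 1 = 0 := by
    rw [← Matrix.trace_fin_two, hR, Matrix.trace_mul_comm, ← Matrix.mul_assoc, hU.2,
      Matrix.one_mul, htr]
  have hRorth : (s 0 : ℂ) ^ 2 * R 0 0 + (s 1 : ℂ) ^ 2 * R 1 1 = 0 := by
    have e1 : Ψ₀.conjTranspose * Ψ₁ =
        V.transpose.conjTranspose * (S₀.conjTranspose * (R * S₀)) * V.transpose := by
      rw [hΨ₁, hsvd]
      simp only [Matrix.conjTranspose_mul, Matrix.mul_assoc]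
      rw [← Matrix.mul_assoc U.conjTranspose, hU.1, Matrix.one_mul]
    rw [e1, Matrix.trace_mul_comm, ← Matrix.mul_assoc, hV.transpose.2, Matrix.one_mul,
      Matrix.trace_fin_two] at horth
    simp [hS₀, Matrix.mul_apply, Fin.sum_univ_two] at horth
    linear_combination horth
  have hR11 : R 1 1 = -R 0 0 := by linear_combination hRtr
  by_cases hR0 : R 0 0 = 0
  · refine ⟨U, V, s 0, s 1, R 0 1 * s 1, R 1 0 * s 0, hU, hV, hs 0, hs 1, hsvd, ?_⟩
    rw [hΨ₁]
    congr 2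
    ext i j
    fin_cases i <;> fin_cases j <;> simp [hS₀, Matrix.mul_apply, Fin.sum_univ_two, hR0, hR11]
  have hss : s 0 = s 1 := by
    have h2 : ((s 0 : ℂ) ^ 2 - (s 1 : ℂ) ^ 2) * R 0 0 = 0 := by
      rw [hR11] at hRorth
      linear_combination hRorth
    have h3 := (mul_eq_zero.1 h2).resolve_right hR0
    have h4 : s 0 ^ 2 = s 1 ^ 2 := by
      have : (s 0 : ℂ) ^ 2 = (s 1 : ℂ) ^ 2 := sub_eq_zero.1 h3
      exact_mod_cast this
    exact (sq_eq_sq₀ (hs 0).le (hs 1).le).1 h4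
  have hS₀' : S₀ = (s 0 : ℂ) • 1 := by
    rw [hS₀, ← hss]
    ext i j
    fin_cases i <;> fin_cases j <;> simp
  have hs0 := hs 0
  have hnormS : 2 * s 0 ^ 2 = 1 := by
    rw [hsvd, frobSq_mul_unitary hV.transpose, frobSq_unitary_mul hU] at h₀
    simp [frobSq, hS₀, Fin.sum_univ_two, ← hss] at h₀
    linarith
  have hRnorm : 2 * ‖R 0 0‖ ^ 2 + ‖R 0 1‖ ^ 2 + ‖R 1 0‖ ^ 2 = 2 := by
    rw [hΨ₁, frobSq_mul_unitary hV.transpose, frobSq_unitary_mul hU, hS₀', Matrix.mul_smul,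
      Matrix.mul_one, frobSq_smul, Complex.norm_real, Real.norm_eq_abs, sq_abs] at h₁
    simp only [frobSq, Fin.sum_univ_two, hR11, norm_neg] at h₁
    nlinarith
  have hRdet : ‖R.det‖ = 1 := by
    have hTR : R.det = T.det := by
      rw [hR, Matrix.det_mul, Matrix.det_mul, mul_right_comm, ← Matrix.det_mul, hU.1,
        Matrix.det_one, one_mul]
    rw [← hT, Matrix.det_mul, norm_mul] at hdet'
    rw [hTR]
    exact mul_right_cancel₀ (norm_ne_zero_iff.2 hdet) (by rw [one_mul, ← hdet'])
  have hqr : ‖R 0 1‖ = ‖R 1 0‖ := by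
    have h5 : (1 : ℝ) ≤ ‖R 0 0‖ ^ 2 + ‖R 0 1‖ * ‖R 1 0‖ := by
      rw [← hRdet, Matrix.det_fin_two, hR11, ← norm_pow, ← norm_mul]
      refine (norm_sub_le _ _).trans (le_of_eq ?_)
      rw [mul_neg, norm_neg, sq]
    have h6 : (‖R 0 1‖ - ‖R 1 0‖) ^ 2 ≤ 0 := by nlinarith
    have h7 : ‖R 0 1‖ - ‖R 1 0‖ = 0 :=
      pow_eq_zero_iff two_ne_zero |>.1 (le_antisymm h6 (sq_nonneg _))
    linarith
  -- The vectors `(1, ± y) / √2` give `R` a vanishing diagonal.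
  obtain ⟨y, hy, hyR⟩ : ∃ y : ℂ, starRingEnd ℂ y * y = 1 ∧
      R 0 1 * y + R 1 0 * starRingEnd ℂ y = 0 := by
    by_cases hq : R 0 1 = 0
    · have hr : R 1 0 = 0 := by
        rw [← norm_eq_zero, ← hqr, hq, norm_zero]
      exact ⟨1, by simp, by simp [hq, hr]⟩
    · obtain ⟨y, hy⟩ := IsAlgClosed.exists_pow_nat_eq (-R 1 0 / R 0 1) two_pos
      have hyn : ‖y‖ = 1 := by
        refine (pow_eq_one_iff_of_nonneg (norm_nonneg _) two_ne_zero).1 ?_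
        rw [← norm_pow, hy, norm_div, norm_neg, hqr, div_self]
        rw [← hqr]
        exact norm_ne_zero_iff.2 hq
      have hyy : starRingEnd ℂ y * y = 1 := by
        rw [Complex.conj_mul', hyn]; simp
      refine ⟨y, hyy, ?_⟩
      have h8 : R 0 1 * y ^ 2 = -R 1 0 := by rw [hy, mul_div_cancel₀ _ hq]
      linear_combination starRingEnd ℂ y * h8 - R 0 1 * y * hyy
  set t : ℂ := (((Real.sqrt 2)⁻¹ : ℝ) : ℂ) with htdef
  have htt : t * t = 1 / 2 := by
    rw [htdef, ← Complex.ofReal_mul, ← mul_inv, Real.mul_self_sqrt (by norm_num)]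
    norm_num
  have htconj : starRingEnd ℂ t = t := Complex.conj_ofReal _
  let Q : Matrix (Fin 2) (Fin 2) ℂ := !![t, t; t * y, -(t * y)]
  have hQ : IsUnitary Q := by
    refine isUnitary_of_left ?_
    ext i j
    fin_cases i <;> fin_cases j <;>
      simp [Q, Matrix.mul_apply, Fin.sum_univ_two, Matrix.conjTranspose_apply, htconj]
    · linear_combination (1 + starRingEnd ℂ y * y) * htt + hy / 2
    · linear_combination (1 - starRingEnd ℂ y * y) * htt - hy / 2
    · linear_combination (1 - starRingEnd ℂ y * y) * htt - hy / 2
    · linear_combination (1 + starRingEnd ℂ y * y) * htt + hy / 2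
  refine ⟨U * Q, V * Q.conjTranspose.transpose, s 0, s 0,
    s 0 * (Q.conjTranspose * R * Q) 0 1, s 0 * (Q.conjTranspose * R * Q) 1 0, hU.mul hQ,
    hV.mul hQ.conjTranspose.transpose, hs0, hs0, ?_, ?_⟩
  · have e1 : !![(s 0 : ℂ), 0; 0, (s 0 : ℂ)] = S₀ := by rw [hS₀, ← hss]
    rw [e1, hS₀', hsvd, hS₀', Matrix.transpose_mul, Matrix.transpose_transpose]
    simp only [Matrix.mul_smul, Matrix.smul_mul, Matrix.mul_one, Matrix.mul_assoc]
    rw [← Matrix.mul_assoc Q, hQ.2, Matrix.one_mul]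
  · have e2 : !![0, (s 0 : ℂ) * (Q.conjTranspose * R * Q) 0 1;
        (s 0 : ℂ) * (Q.conjTranspose * R * Q) 1 0, 0] = (s 0 : ℂ) • (Q.conjTranspose * R * Q) := by
      have d0 : (Q.conjTranspose * R * Q) 0 0 = 0 := by
        simp [Q, Matrix.mul_apply, Fin.sum_univ_two, Matrix.conjTranspose_apply, htconj, hR11]
        linear_combination t * t * hyR - t * t * R 0 0 * hy
      have d1 : (Q.conjTranspose * R * Q) 1 1 = 0 := by
        simp [Q, Matrix.mul_apply, Fin.sum_univ_two, Matrix.conjTranspose_apply, htconj, hR11]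
        linear_combination -(t * t) * hyR - t * t * R 0 0 * hy
      ext i j
      fin_cases i <;> fin_cases j <;> simp [d0, d1]
    rw [e2, hΨ₁, hS₀', Matrix.transpose_mul, Matrix.transpose_transpose]
    simp only [Matrix.mul_smul, Matrix.smul_mul, Matrix.mul_one, Matrix.mul_assoc]
    rw [← Matrix.mul_assoc Q Q.conjTranspose V.transpose, hQ.2, Matrix.one_mul,
      ← Matrix.mul_assoc Q Q.conjTranspose, hQ.2, Matrix.one_mul]

/-- A diagonal and an antidiagonal `2 × 2` matrix with the same norm and the same modulus of the
determinant form a shifted pair; the phases of the antidiagonal one are absorbed in the bases and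
in an overall phase. -/
theorem isShiftedPair_of_antidiagonal {ψ : Fin 2 → Ket 2} {U V : Matrix (Fin 2) (Fin 2) ℂ}
    {a b : ℝ} {x z : ℂ} (hU : IsUnitary U) (hV : IsUnitary V) (ha : 0 < a) (hb : 0 < b)
    (hab : a ^ 2 + b ^ 2 = 1) (hxz : ‖x‖ ^ 2 + ‖z‖ ^ 2 = 1) (hdet : ‖x‖ * ‖z‖ = a * b)
    (h₀ : ketMatrix (ψ 0) = U * !![(a : ℂ), 0; 0, (b : ℂ)] * V.transpose)
    (h₁ : ketMatrix (ψ 1) = U * !![0, x; z, 0] * V.transpose) : IsShiftedPair ψ := by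
  have hx : x ≠ 0 := by
    rintro rfl
    rw [norm_zero, zero_mul] at hdet
    exact (mul_pos ha hb).ne hdet
  have hz : z ≠ 0 := by
    rintro rfl
    rw [norm_zero, mul_zero] at hdet
    exact (mul_pos ha hb).ne hdet
  have hxn : (‖x‖ : ℂ) ≠ 0 := by exact_mod_cast norm_ne_zero_iff.2 hx
  have hzn : (‖z‖ : ℂ) ≠ 0 := by exact_mod_cast norm_ne_zero_iff.2 hz
  obtain ⟨c, hc⟩ := IsAlgClosed.exists_pow_nat_eq (x * z / (‖x‖ * ‖z‖ : ℂ)) two_pos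
  have hcn : ‖c‖ = 1 := by
    refine (pow_eq_one_iff_of_nonneg (norm_nonneg _) two_ne_zero).1 ?_
    rw [← norm_pow, hc, norm_div, norm_mul, norm_mul, Complex.norm_real, Complex.norm_real,
      norm_norm, norm_norm, div_self (mul_ne_zero (norm_ne_zero_iff.2 hx) (norm_ne_zero_iff.2 hz))]
  have hc0 : c ≠ 0 := by
    rintro rfl
    simp at hcn
  set p : ℂ := x / (c * ‖x‖) with hp
  have hpn : ‖p‖ = 1 := by
    rw [hp, norm_div, norm_mul, hcn, one_mul, Complex.norm_real, norm_norm,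
      div_self (norm_ne_zero_iff.2 hx)]
  have hpp : starRingEnd ℂ p * p = 1 := by
    rw [Complex.conj_mul', hpn]; simp
  have hp0 : p ≠ 0 := by
    intro h
    simp [h] at hpp
  have e1 : c * ‖x‖ * p = x := by
    rw [hp]; field_simp
  have e2 : c * ‖z‖ * starRingEnd ℂ p = z := by
    have h3 : c ^ 2 * (‖x‖ * ‖z‖ : ℂ) = x * z := by
      rw [hc]; field_simp
    refine mul_left_cancel₀ hx ?_
    rw [← h3]
    nth_rewrite 1 [← e1]
    linear_combination c ^ 2 * ‖x‖ * ‖z‖ * hpp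
  have hd : ∀ {q : ℂ}, starRingEnd ℂ q * q = 1 → IsUnitary !![q, 0; 0, 1] := by
    intro q hq
    refine isUnitary_of_left ?_
    ext i j
    fin_cases i <;> fin_cases j <;>
      simp [Matrix.mul_apply, Fin.sum_univ_two, Matrix.conjTranspose_apply, hq]
  obtain ⟨u, hu⟩ := exists_orthonormalBasis_of_isUnitary (hU.mul (hd hpp))
  obtain ⟨v, hv⟩ := exists_orthonormalBasis_of_isUnitary
    (hV.mul (hd (q := starRingEnd ℂ p) (by rw [Complex.conj_conj, mul_comm, hpp])))
  have hsa : Real.sqrt (a ^ 2) = a := Real.sqrt_sq ha.le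
  have hsb : Real.sqrt (1 - a ^ 2) = b := by
    rw [← hab, add_sub_cancel_left, Real.sqrt_sq hb.le]
  have hcoord : ∀ (w₁ w₂ : ℂ) (k₁ k₂ l₁ l₂ i j : Fin 2),
      ketMatrix (w₁ • prodKet (u k₁) (v l₁) + w₂ • prodKet (u k₂) (v l₂)) i j =
        w₁ * (u k₁ i * v l₁ j) + w₂ * (u k₂ i * v l₂ j) := fun _ _ _ _ _ _ _ _ => rfl
  have hcases : (‖x‖ = a ∧ ‖z‖ = b) ∨ (‖z‖ = a ∧ ‖x‖ = b) := by
    have h4 : (‖x‖ ^ 2 - a ^ 2) * (‖x‖ ^ 2 - b ^ 2) = 0 := by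
      have h5 : (‖x‖ * ‖z‖) ^ 2 = (a * b) ^ 2 := by rw [hdet]
      have h6 : ‖z‖ ^ 2 = 1 - ‖x‖ ^ 2 := by linarith
      rw [mul_pow, h6] at h5
      have h7 : b ^ 2 = 1 - a ^ 2 := by linarith
      rw [mul_pow, h7] at h5
      rw [h7]
      linarith
    have hxp := norm_nonneg x
    have hzp := norm_nonneg z
    rcases mul_eq_zero.1 h4 with h | h
    · exact Or.inl ⟨(sq_eq_sq₀ hxp ha.le).1 (by linarith), (sq_eq_sq₀ hzp hb.le).1 (by linarith)⟩
    · exact Or.inr ⟨(sq_eq_sq₀ hzp ha.le).1 (by linarith), (sq_eq_sq₀ hxp hb.le).1 (by linarith)⟩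
  refine ⟨u, v, a ^ 2, c, by positivity, by nlinarith, hcn, ketMatrix_injective ?_, ?_⟩
  · rw [h₀, hsa, hsb]
    ext i j
    rw [hcoord]
    simp [hu, hv, Matrix.mul_apply, Fin.sum_univ_two]
    linear_combination -(a * U i 0 * V j 0) * hpp
  rcases hcases with ⟨hxa, hzb⟩ | ⟨hza, hxb⟩
  · left
    refine ketMatrix_injective ?_
    rw [h₁, hsa, hsb, ketMatrix_smul, ← hxa, ← hzb]
    ext i j
    rw [Matrix.smul_apply, hcoord, smul_eq_mul]
    simp [hu, hv, Matrix.mul_apply, Fin.sum_univ_two]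
    linear_combination -(U i 0 * V j 1) * e1 - (U i 1 * V j 0) * e2
  · right
    refine ketMatrix_injective ?_
    rw [h₁, hsa, hsb, ketMatrix_smul, ← hza, ← hxb]
    ext i j
    rw [Matrix.smul_apply, hcoord, smul_eq_mul]
    simp [hu, hv, Matrix.mul_apply, Fin.sum_univ_two]
    linear_combination -(U i 0 * V j 1) * e1 - (U i 1 * V j 0) * e2

/-- Two orthogonal entangled qubit states that can be cloned form a shifted pair. -/
theorem MatrixClonable.isShiftedPair {ψ : Fin 2 → Ket 2} {φ : Ket 2} (hψ : Orthonormal ℂ ψ)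
    (hent : ∀ i, IsEntangled (ψ i))
    (h : MatrixClonable (fun i => ketMatrix (ψ i)) (ketMatrix φ)) : IsShiftedPair ψ := by
  have hdet : ∀ i, (ketMatrix (ψ i)).det ≠ 0 := fun i => (hent i).det_ne_zero
  have hfrob : ∀ i, frobSq (ketMatrix (ψ i)) = 1 := fun i => by
    rw [frobSq_ketMatrix, hψ.1, one_pow]
  have horth : ((ketMatrix (ψ 0)).conjTranspose * ketMatrix (ψ 1)).trace = 0 := by
    have h1 : inner ℂ (ψ 0) (ψ 1) = 0 := hψ.2 (by decide)
    rw [EuclideanSpace.inner_eq_star_dotProduct, dotProduct_comm] at h1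
    rw [← h1]
    simp only [Matrix.trace, Matrix.diag, Matrix.mul_apply, dotProduct, Fintype.sum_prod_type]
    rw [Finset.sum_comm]
    rfl
  have hdeteq := h.norm_det_eq hdet 0 1
  set Ψ₀ := ketMatrix (ψ 0)
  set Ψ₁ := ketMatrix (ψ 1)
  set T := Ψ₁ * Ψ₀⁻¹ with hTdef
  have hT : T * Ψ₀ = Ψ₁ := by
    rw [hTdef, Matrix.mul_assoc, Matrix.nonsing_inv_mul _ (hdet 0).isUnit, Matrix.mul_one]
  have hTdet : T.det ≠ 0 := by
    intro h0
    apply hdet 1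
    change Ψ₁.det = 0
    rw [← hT, Matrix.det_mul, h0, zero_mul]
  obtain ⟨M, A, B, c, -, h2, h3⟩ := h
  obtain ⟨m, hm⟩ := exists_ne_zero_of_sum_norm_sq (h3 0)
  have h20 : A m * (Ψ₀ ⊗ₖ ketMatrix φ) * (B m).transpose = c 0 m • (Ψ₀ ⊗ₖ Ψ₀) := h2 0 m
  have h21 : A m * (Ψ₁ ⊗ₖ ketMatrix φ) * (B m).transpose = c 1 m • (Ψ₁ ⊗ₖ Ψ₁) := h2 1 m
  have hA : IsUnit (A m) := by
    rw [Matrix.isUnit_iff_isUnit_det, isUnit_iff_ne_zero]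
    intro h0
    have h4 := congrArg Matrix.det h20
    rw [Matrix.det_mul, Matrix.det_mul, h0, zero_mul, zero_mul, Matrix.det_smul,
      Matrix.det_kronecker] at h4
    have h5 : Ψ₀.det ≠ 0 := hdet 0
    simp [hm, h5] at h4
  have htr : T.trace = 0 := by
    refine trace_eq_zero_of_intertwines hA hTdet
      (kraus_intertwines hm (hdet 0) h20 (by rw [hT]; exact h21)) fun z hz => ?_
    have h5 : Ψ₁ = z • Ψ₀ := by rw [← hT, hz, Matrix.smul_mul, Matrix.one_mul]
    rw [h5, Matrix.mul_smul, Matrix.trace_smul, trace_conjTranspose_mul_self_eq_frobSq,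
      hfrob 0] at horth
    apply hTdet
    have : z = 0 := by simpa using horth
    simp [hz, this]
  obtain ⟨U, V, a, b, x, z, hU, hV, ha, hb, e₀, e₁⟩ :=
    exists_bases_antidiagonal hT htr (hdet 0) hdeteq (hfrob 0) (hfrob 1) horth
  have hUV : ‖U.det‖ * ‖V.det‖ ≠ 0 := by
    have := hdet 0
    intro h0
    apply this
    change Ψ₀.det = 0
    rw [← norm_eq_zero, e₀, Matrix.det_mul, Matrix.det_mul, norm_mul, norm_mul,
      Matrix.det_transpose, mul_right_comm, h0, zero_mul]
  refine isShiftedPair_of_antidiagonal hU hV ha hb ?_ ?_ ?_ e₀ e₁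
  · have h6 := hfrob 0
    change frobSq Ψ₀ = 1 at h6
    rw [e₀, frobSq_mul_unitary hV.transpose, frobSq_unitary_mul hU] at h6
    simpa [frobSq, Fin.sum_univ_two] using h6
  · have h6 := hfrob 1
    change frobSq Ψ₁ = 1 at h6
    rw [e₁, frobSq_mul_unitary hV.transpose, frobSq_unitary_mul hU] at h6
    simpa [frobSq, Fin.sum_univ_two] using h6
  · rw [e₀, e₁, Matrix.det_mul, Matrix.det_mul, Matrix.det_mul, Matrix.det_mul, norm_mul,
      norm_mul, norm_mul, norm_mul, Matrix.det_transpose] at hdeteq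
    have h7 : ‖(!![(a : ℂ), 0; 0, (b : ℂ)]).det‖ = ‖(!![0, x; z, 0]).det‖ :=
      mul_left_cancel₀ hUV (by linear_combination hdeteq)
    simp [Matrix.det_fin_two, abs_of_pos ha, abs_of_pos hb] at h7
    exact h7.symm

end Qubits

/-! ### Shifted pairs as group-shifted states -/

/-- Clonability by LOCC does not depend on overall phases, nor on the labels of the states. -/
theorem LOCCClonable.of_phases {D : ℕ} {ι κ : Type} {ψ : ι → Ket D} {χ : κ → Ket D} {φ : Ket D}
    (h : LOCCClonable χ φ) (σ : ι → κ) {c : ι → ℂ} (hc : ∀ i, ‖c i‖ = 1)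
    (hψ : ∀ i, ψ i = c i • χ (σ i)) : LOCCClonable ψ φ := by
  obtain ⟨L, hL, hclone⟩ := h
  refine ⟨L, hL, fun i => ?_⟩
  have h1 : joint (ψ i) φ = c i • joint (χ (σ i)) φ := by
    funext x
    simp only [hψ, joint, Pi.smul_apply, PiLp.smul_apply, smul_eq_mul]
    ring
  have h2 : joint (ψ i) (ψ i) = (c i * c i) • joint (χ (σ i)) (χ (σ i)) := by
    funext x
    simp only [hψ, joint, Pi.smul_apply, PiLp.smul_apply, smul_eq_mul]
    ring
  have hphase : ∀ {z : ℂ} {v : (Fin D × Fin D) × (Fin D × Fin D) → ℂ}, ‖z‖ = 1 →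
      ketbra (z • v) = ketbra v := by
    intro z v hz
    rw [ketbra_smul, hz]
    simp
  rw [h1, h2, hphase (hc i), hphase (by rw [norm_mul, hc, one_mul]), hclone]

/-- A shifted pair consists of the shifts by the two elements of a group of order two, up to
phases. -/
theorem IsShiftedPair.exists_group_shift {ψ : Fin 2 → Ket 2} (h : IsShiftedPair ψ) :
    ∃ (e : Fin 2 ≃ Multiplicative (ZMod 2)) (l : Multiplicative (ZMod 2) → ℝ)
      (c : Multiplicative (ZMod 2) → ℂ)
      (u v : OrthonormalBasis (Multiplicative (ZMod 2)) ℂ (EuclideanSpace ℂ (Fin 2))),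
      (∀ g, 0 < l g) ∧ ∑ g, l g = 1 ∧ (∀ f, ‖c f‖ = 1) ∧
      ((∀ i, ψ i = c (e i) • ∑ g, (Real.sqrt (l g) : ℂ) • prodKet (u g) (v (e i * g))) ∨
        (∀ i, ψ i = c (e i) • ∑ g, (Real.sqrt (l g) : ℂ) • prodKet (u (e i * g)) (v g))) := by
  obtain ⟨u, v, l, c, hl0, hl1, hc, h0, h1⟩ := h
  obtain ⟨e, e00, e01, e10, e11⟩ : ∃ e : Fin 2 ≃ Multiplicative (ZMod 2),
      e 0 * e 0 = e 0 ∧ e 0 * e 1 = e 1 ∧ e 1 * e 0 = e 1 ∧ e 1 * e 1 = e 0 :=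
    ⟨Multiplicative.ofAdd, by decide⟩
  have hsum : ∀ {X : Type} [AddCommMonoid X] (F : Multiplicative (ZMod 2) → X),
      ∑ g, F g = F (e 0) + F (e 1) := by
    intro X _ F
    rw [← Equiv.sum_comp e, Fin.sum_univ_two]
  refine ⟨e, fun g => if e.symm g = 0 then l else 1 - l, fun g => if e.symm g = 0 then 1 else c,
    u.reindex e, v.reindex e, fun g => ?_, ?_, fun g => ?_, ?_⟩
  · dsimp only
    split_ifs <;> linarith
  · rw [hsum]
    simp
  · dsimp only
    split_ifs
    · exact norm_one
    · exact hc
  · refine h1.imp (fun h1 i => ?_) (fun h1 i => ?_)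
    · rw [hsum]
      fin_cases i
      · simp [e00, e01, h0]
      · simp [e10, e11, h1]
    · rw [hsum]
      fin_cases i
      · simp [e00, e01, h0]
      · simp [e10, e11, h1]

theorem norm_sq_sqrt_mul_phase {a : ℝ} (ha : 0 ≤ a) {z : ℂ} (hz : ‖z‖ = 1) :
    ‖(Real.sqrt a : ℂ) * z‖ ^ 2 = a := by
  rw [norm_mul, hz, mul_one, Complex.norm_real, Real.norm_eq_abs, sq_abs, Real.sq_sqrt ha]

theorem IsShiftedPair.locc_clonable {ψ : Fin 2 → Ket 2} {φ : Ket 2} (h : IsShiftedPair ψ)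
    (hφ : IsMaximallyEntangled φ) : LOCCClonable ψ φ := by
  obtain ⟨e, l, c, u, v, hl, hsum, hc, hψ⟩ := h.exists_group_shift
  have hd : ∑ g, ‖(Real.sqrt (l g) : ℂ)‖ ^ 2 = 1 := by
    rw [← hsum]
    refine Finset.sum_congr rfl fun g _ => ?_
    simpa using norm_sq_sqrt_mul_phase (hl g).le norm_one
  rcases hψ with hψ | hψ
  · exact (locc_clonable_of_shift_right hd (fun _ => rfl) hφ).of_phases _ (fun i => hc _) hψ
  · exact (locc_clonable_of_shift_left hd (fun _ => rfl) hφ).of_phases _ (fun i => hc _) hψ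

theorem IsShiftedPair.isMaximallyEntangled {ψ : Fin 2 → Ket 2} {φ : Ket 2} (h : IsShiftedPair ψ)
    (hφ : ‖φ‖ = 1) (hclone : MatrixClonable (fun i => ketMatrix (ψ i)) (ketMatrix φ)) :
    IsMaximallyEntangled φ := by
  obtain ⟨e, l, c, u, v, hl, hsum, hc, hψ⟩ := h.exists_group_shift
  obtain ⟨M, A, B, z, h1, h2, h3⟩ := hclone
  refine MatrixClonable.isMaximallyEntangled (ψ := fun f => ψ (e.symm f)) (by simp) hl hsum
    (w := fun f g => (Real.sqrt (l g) : ℂ) * c f)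
    (fun f g => norm_sq_sqrt_mul_phase (hl g).le (hc f)) hφ u v ?_
    ⟨M, A, B, fun f => z (e.symm f), h1, fun f => h2 (e.symm f), fun f => h3 (e.symm f)⟩
  refine hψ.imp (fun hψ f => ?_) (fun hψ f => ?_)
  · rw [hψ, Equiv.apply_symm_apply, Finset.smul_sum]
    exact Finset.sum_congr rfl fun g _ => by rw [smul_smul, mul_comm]
  · rw [hψ, Equiv.apply_symm_apply, Finset.smul_sum]
    exact Finset.sum_congr rfl fun g _ => by rw [smul_smul, mul_comm]

end LocalCloning

theorem theorem11 :
    -- two entangled qubit states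
    (∀ (ψ : Fin 2 → LocalCloning.Ket 2) (φ : LocalCloning.Ket 2),
      Orthonormal ℂ ψ → (∀ i, LocalCloning.IsEntangled (ψ i)) → ‖φ‖ = 1 →
        (LocalCloning.SeparablyClonable ψ φ ↔
          LocalCloning.IsMaximallyEntangled φ ∧ LocalCloning.IsShiftedPair ψ) ∧
        (LocalCloning.LOCCClonable ψ φ ↔
          LocalCloning.IsMaximallyEntangled φ ∧ LocalCloning.IsShiftedPair ψ)) ∧
    -- three group-shifted qutrit states
    (∀ (G : Type) [Group G] [Fintype G] (l : G → ℝ) (θ : G → G → ℝ)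
        (ψ : G → LocalCloning.Ket 3) (φ : LocalCloning.Ket 3),
      LocalCloning.IsGroupShifted l θ ψ → ‖φ‖ = 1 →
        (LocalCloning.SeparablyClonable ψ φ → LocalCloning.IsMaximallyEntangled φ) ∧
        (LocalCloning.LOCCClonable ψ φ → LocalCloning.IsMaximallyEntangled φ) ∧
        ((∀ f g, θ f g = 0) →
          (LocalCloning.SeparablyClonable ψ φ ↔ LocalCloning.IsMaximallyEntangled φ) ∧
          (LocalCloning.LOCCClonable ψ φ ↔ LocalCloning.IsMaximallyEntangled φ))) := by
  classical
  refine ⟨fun ψ φ hψ hent hφ => ?_, fun G _ _ l θ ψ φ hψ hφ => ?_⟩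
  · have nec : LocalCloning.SeparablyClonable ψ φ →
        LocalCloning.IsMaximallyEntangled φ ∧ LocalCloning.IsShiftedPair ψ := by
      intro h
      have hm := h.matrixClonable hψ.1
      have hs := hm.isShiftedPair hψ hent
      exact ⟨hs.isMaximallyEntangled hφ hm, hs⟩
    have suf : LocalCloning.IsMaximallyEntangled φ ∧ LocalCloning.IsShiftedPair ψ →
        LocalCloning.LOCCClonable ψ φ := fun h => h.2.locc_clonable h.1
    exact ⟨⟨nec, fun h => (suf h).separablyClonable⟩,
      ⟨fun h => nec h.separablyClonable, suf⟩⟩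
  · obtain ⟨hl, hsum, u, v, hψ⟩ := hψ
    have hphase : ∀ f g, ‖Complex.exp (Complex.I * (θ f g : ℂ))‖ = 1 := fun f g => by
      rw [mul_comm, Complex.norm_exp_ofReal_mul_I]
    have hw : ∀ f g,
        ‖(Real.sqrt (l g) : ℂ) * Complex.exp (Complex.I * (θ f g : ℂ))‖ ^ 2 = l g :=
      fun f g => LocalCloning.norm_sq_sqrt_mul_phase (hl g).le (hphase f g)
    have nec : LocalCloning.SeparablyClonable ψ φ → LocalCloning.IsMaximallyEntangled φ :=
      fun h => (h.matrixClonable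
        (LocalCloning.norm_eq_one_of_sum_shift hsum hw u v hψ)).isMaximallyEntangled
          (LocalCloning.card_eq_of_orthonormalBasis u).le hl hsum hw hφ u v hψ
    refine ⟨nec, fun h => nec h.separablyClonable, fun hθ => ?_⟩
    have suf : LocalCloning.IsMaximallyEntangled φ → LocalCloning.LOCCClonable ψ φ := by
      intro h
      have hd : ∑ g, ‖(Real.sqrt (l g) : ℂ)‖ ^ 2 = 1 := by
        rw [← hsum]
        refine Finset.sum_congr rfl fun g _ => ?_
        simpa using LocalCloning.norm_sq_sqrt_mul_phase (hl g).le norm_one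
      simp only [hθ, Complex.ofReal_zero, mul_zero, Complex.exp_zero, mul_one] at hψ
      rcases hψ with hψ | hψ
      · exact LocalCloning.locc_clonable_of_shift_right hd hψ h
      · exact LocalCloning.locc_clonable_of_shift_left hd hψ h
    exact ⟨⟨nec, fun h => (suf h).separablyClonable⟩, ⟨fun h => nec h.separablyClonable, suf⟩⟩
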